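/- All graphs are finite and simple. A *hole* of a graph is an induced cycle of length at least four; a graph is *$\ell$-holed* if all its holes have length exactly $\ell$. **Theorem.** Let $\ell\ge 5$. If $G$ is a blow-up of an $\ell$-cycle, or $G$ is a blow-up of an $\ell$-framework, then $G$ is $\ell$-holed. **Terminology.** Disjoint sets $X,Y\subseteq V(G)$ are *complete* (*anticomplete*) if all (no) edges between them are present. $G[X,Y]$ is the bipartite graph formed by the edges of $G$ between $X$ and $Y$; it is a *half-graph* if it has no induced two-edge matching. It *obeys* orderings $x_1,\dots,x_p$ of $X$ and $y_1,\dots,y_q$ of $Y$ if, whenever $i\le i'$, $j\le j'$ and $x_{i'}y_{j'}$ is an edge, $x_iy_j$ is an edge. **Blow-up of an $\ell$-cycle.** A graph $G$ whose vertex set is partitioned into non-empty cliques $W_i$ ($i\in\mathbb Z/\ell$) such that every $G[W_{i-1},W_i]$ is a half-graph; if $i\ne j$ and there is an edge between $W_i$ and $W_j$ then $j=i\pm1$; and every $G[W_i,W_{i-1}\cup W_{i+1}]$ is a half-graph. **Arborescences.** An *arborescence* is a tree with edges directed away from one vertex, its *apex*. A *leaf* is a vertex different from the apex with outdegree zero;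 $L(T)$ is the set of leaves of $T$. If $S$ is a tree with $V(S)=L(T)$, then $T$ *lives in* $S$ if for every $v\in V(T)$ the set of leaves reachable from $v$ by a directed path is the vertex set of a subtree of $S$. Arborescences $T,T'$ are *coarboreal* under a bijection $\phi:L(T)\to L(T')$ if, after identifying each leaf with its image under $\phi$, both live in a common tree. **$\ell$-frameworks.** An $\ell$-framework consists of integers $0\le m\le k$, vertices $a_0,\dots,a_k$ and $b_1,\dots,b_k$ (and also $b_0$ if $\ell$ is even), pairwise vertex-disjoint paths $P_1,\dots,P_k$ where $P_i$ has ends $a_i,b_i$, and two vertex-disjoint arborescences $T,S$, where $V(P_i)\cap V(T)=\{a_i\}$ and $V(P_i)\cap V(S)=\{b_i\}$ for $1\le i\le k$, and every vertex lies in $T$, in $S$ or in some $P_i$. If $\ell$ is odd every $P_i$ has length $(\ell-3)/2$; if $\ell$ is even, $P_i$ has length $\ell/2-1$ for $1\le i\le m$ and $\ell/2-2$ for $m<i\le k$. *Upper part.* For $0\le i\le m$ there is an arborescence $T_i$ with apex $a_i$ and $L(T_i)=\{a_p:p\in I_i\}$, the $T_i$ being pairwise disjoint. The sets $I_0,\dots,I_m$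 are intervals of integers (possibly empty) with union $\{m+1,\dots,k\}$; if $i<i'$ then every element of $I_{i'}$ is smaller than every element of $I_i$; and $I_0\neq\emptyset$. If $I_i=\emptyset$ then $V(T_i)=\{a_i\}$; otherwise $T_i$ is called an *upper tent-arborescence*. $T$ is obtained from $T_0\cup\dots\cup T_m$ by adding, for $1\le i\le m$, one edge directed from a non-leaf vertex of $T_{i-1}$ (that is, a vertex not in $L(T_{i-1})$) to $a_i$. *Lower part, $\ell$ odd.* For $m+1\le j\le k$ there is an arborescence $S_j$ with apex $b_j$ and $L(S_j)=\{b_p:p\in J_j\}$, the $S_j$ being pairwise disjoint. The sets $J_{m+1},\dots,J_k$ are intervals (possibly empty) with union $\{1,\dots,m\}$; if $j<j'$ then every element of $J_{j'}$ is smaller than every element of $J_j$. If $J_j=\emptyset$ then $V(S_j)=\{b_j\}$; otherwise $S_j$ is a *lower tent-arborescence*. $S$ (with apex $b_k$) is obtained from their union by adding, for $m+1\le i\le k-1$, one edge directed from a non-leaf vertex of $S_{i+1}$ to $b_i$. Moreover, let $N$ be the total number of (upper and lower) tent-arborescences. For every $i$ with $I_i\ne\emptyset$, except the largest such $i$ when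 $N$ is odd, the index $j=\min I_i$ satisfies $J_j\ne\emptyset$; and for every $j$ with $J_j\neq\emptyset$, except the smallest such $j$ when $N$ is even, the index $i=\max J_j$ satisfies $I_i\neq\emptyset$. *Lower part, $\ell$ even.* $I_m\ne\emptyset$. Put $J_0=I_m$ and $J_{i+1}=I_i$ for $0\le i<m$. For $0\le j\le m$ there is an arborescence $S_j$ with apex $b_j$ and $L(S_j)=\{b_p:p\in J_j\}$, pairwise disjoint, with $V(S_j)=\{b_j\}$ if $J_j=\emptyset$; otherwise $S_j$ is a *lower tent-arborescence*. $S$ (with apex $b_0$) is obtained from their union by adding, for $1\le i\le m-1$, one edge directed from a non-leaf vertex of $S_{i+1}$ to $b_i$ and, if $m\ge1$, one edge directed from a non-leaf vertex of $S_0$ to $b_m$. Moreover, whenever $I_i\neq\emptyset$, $T_i$ and $S_{i+1}$ ($S_0$ if $i=m$) are coarboreal under the bijection $a_p\mapsto b_p$ $(p\in I_i)$. **Blow-up of an $\ell$-framework $F$.** Let $D$ be the graph on $V(F)$ in which distinct $u,v$ are adjacent if they are adjacent in some $P_i$ or there is a directed path of $T$ or of $S$ from one of them to the other. A graph $G$ is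 a blow-up of $F$ if $D$ is an induced subgraph of $G$ and there are pairwise disjoint cliques $W_t$ $(t\in V(D))$ of $G$ with union $V(G)$ and $W_t\cap V(D)=\{t\}$, where $W_t=\{t\}$ if $t$ is in no $P_i$, and for each $t$ a linear ordering of $W_t$ with first term $t$, such that: 1. for distinct $t,t'$: if $t,t'$ are not $D$-adjacent then $W_t,W_{t'}$ are anticomplete; if they are $D$-adjacent then $G[W_t,W_{t'}]$ obeys the orderings of $W_t,W_{t'}$ and all its vertices have positive degree; 2. if $t,t'\in\{a_1,\dots,a_k\}$ or $t,t'\in\{b_1,\dots,b_k\}$, and $t,t'$ are $D$-adjacent, then $W_t$ is complete to $W_{t'}$; 3. if $t\in V(T)$, $0\le i\le m$ and $a_i,t$ are $D$-adjacent, then $W_t$ is complete to $W_{a_i}$; if $t\in V(S)$ and $b_i,t$ are $D$-adjacent, where $m+1\le i\le k$ if $\ell$ is odd and $0\le i\le m$ if $\ell$ is even, then $W_t$ is complete to $W_{b_i}$; 4. for each upper tent-arborescence $T_j$ and each $t\in L(T_j)$, if the path $Q$ of $T$ from its apex $a_0$ to $t$ has vertices $y_1,\dots,y_p,a_j,z_1,\dots,z_q=t$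 in order (with $p=0$ if $j=0$), then $W_t$ is complete to $\{y_1,\dots,y_p,a_j\}$, $W_t$ is anticomplete to $W_u$ for every $u\in V(T)\setminus V(Q)$, and $G[W_t,\{z_1,\dots,z_{q-1}\}]$ obeys the ordering of $W_t$ and the ordering $z_1,\dots,z_{q-1}$; and the same holds for each lower tent-arborescence $S_j$, with $T$, $a_0$, $a_j$ replaced by $S$, the apex of $S$, and $b_j$. -/

import Mathlib

/-! ### Holes, half-graphs, blow-ups of cycles -/

/-- A hole is an induced cycle of length at least four; `G` is `ℓ`-holed if every hole of `G`
has length exactly `ℓ`. -/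
def IsHoled {V : Type*} (G : SimpleGraph V) (ℓ : ℕ) : Prop :=
  ∀ n : ℕ, 4 ≤ n → Nonempty (SimpleGraph.cycleGraph n ↪g G) → n = ℓ

/-- Every vertex of `X` is adjacent to every vertex of `Y`. -/
def CompleteTo {V : Type*} (G : SimpleGraph V) (X Y : Set V) : Prop :=
  ∀ x ∈ X, ∀ y ∈ Y, G.Adj x y

/-- There are no edges between `X` and `Y`. -/
def AnticompleteTo {V : Type*} (G : SimpleGraph V) (X Y : Set V) : Prop :=
  ∀ x ∈ X, ∀ y ∈ Y, ¬ G.Adj x y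

/-- For disjoint `X`, `Y`: the bipartite graph `G[X, Y]` is a half-graph, that is, it has no induced
two-edge matching. -/
def IsHalfGraph {V : Type*} (G : SimpleGraph V) (X Y : Set V) : Prop :=
  ∀ x ∈ X, ∀ x' ∈ X, ∀ y ∈ Y, ∀ y' ∈ Y,
    G.Adj x y → G.Adj x' y' → G.Adj x y' ∨ G.Adj x' y

/-- `G[X, Y]` obeys the orderings `xs = (x₁, …, xₘ)` and `ys = (y₁, …, yₙ)` of `X` and `Y`: whenever
`i ≤ i'`, `j ≤ j'` and `x_{i'} y_{j'}` is an edge, also `x_i y_j` is an edge. -/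
def Obeys {V : Type*} (G : SimpleGraph V) (xs ys : List V) : Prop :=
  ∀ (i i' : Fin xs.length) (j j' : Fin ys.length), i ≤ i' → j ≤ j' →
    G.Adj (xs.get i') (ys.get j') → G.Adj (xs.get i) (ys.get j)

/-- `G` is a blow-up of an `ℓ`-cycle. -/
def IsCycleBlowup {V : Type*} (G : SimpleGraph V) (ℓ : ℕ) : Prop :=
  ∃ W : ZMod ℓ → Set V,
    (∀ v : V, ∃! i, v ∈ W i) ∧
    (∀ i, (W i).Nonempty ∧ G.IsClique (W i)) ∧
    (∀ i, IsHalfGraph G (W (i - 1)) (W i)) ∧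
    (∀ i j, i ≠ j → (∃ x ∈ W i, ∃ y ∈ W j, G.Adj x y) → j = i + 1 ∨ j = i - 1) ∧
    -- compatibility of `G[W i, W (i + 1)]` and `G[W i, W (i - 1)]`
    (∀ i, IsHalfGraph G (W i) (W (i + 1) ∪ W (i - 1)))

/-! ### Arborescences -/

/-- An arborescence with vertex set `verts ⊆ U`: a directed tree in which no two arcs have a common
head, equivalently all arcs point away from the apex. -/
structure Arborescence (U : Type*) where
  verts : Set U
  Arc : U → U → Prop
  apex : U
  apex_mem : apex ∈ verts
  arc_mem : ∀ u v, Arc u v → u ∈ verts ∧ v ∈ verts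
  not_arc_apex : ∀ u, ¬ Arc u apex
  arc_head_unique : ∀ u v w, Arc u w → Arc v w → u = v
  reachable : ∀ v ∈ verts, Relation.ReflTransGen Arc apex v

/-- The leaves: vertices other than the apex with outdegree zero. -/
def Arborescence.leaves {U : Type*} (A : Arborescence U) : Set U :=
  {v | v ∈ A.verts ∧ v ≠ A.apex ∧ ∀ w, ¬ A.Arc v w}

/-- `A` lives in the tree `R`. The vertices of `R` are labels of the leaves of `A` (via `leaf`).
For each vertex `v` of `A`, the set of leaves that can be reached from `v` must be the vertex set
of a subtree of `R`. -/
def Arborescence.LivesIn {U L : Type*} (A : Arborescence U) (leaf : L → U)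
    (R : SimpleGraph L) : Prop :=
  ∀ v ∈ A.verts, (R.induce {x | Relation.ReflTransGen A.Arc v (leaf x)}).Connected

/-- `A` and `A'`, whose leaves are labelled by `L` via `leaf` and `leaf'`, are coarboreal under the
bijection `leaf x ↦ leaf' x`. -/
def Coarboreal {U L : Type*} (A A' : Arborescence U) (leaf leaf' : L → U) : Prop :=
  ∃ R : SimpleGraph L, R.IsTree ∧ A.LivesIn leaf R ∧ A'.LivesIn leaf' R

/-! ### Frameworks -/

/-- The objects that make up an `ℓ`-framework with vertex set `U`. Families are indexed by `ℕ`;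
only the values at the indices that occur in `Framework` below matter.

* `bar i s` (`1 ≤ i ≤ k`) is the `s`-th vertex of the path `P_i` from `a i` to `b i`;
* `upper i` is the upper tent-arborescence with apex `a i`, and its base is
  `{a p | p ∈ upperBase i}`; if there is no upper tent with apex `a i`, then `upperBase i = ∅` and
  `upper i` is the one-vertex arborescence with vertex `a i`; similarly for `lower`;
* `upperJoint i` is the tail of the arc that leaves `upper i` to the apex of the next one;
  similarly for `lowerJoint`. -/
structure FrameworkData (ℓ : ℕ) (U : Type*) where
  k : ℕ
  m : ℕ
  a : ℕ → U
  b : ℕ → U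
  bar : ℕ → ℕ → U
  upperBase : ℕ → Finset ℕ
  lowerBase : ℕ → Finset ℕ
  upper : ℕ → Arborescence U
  lower : ℕ → Arborescence U
  upperJoint : ℕ → U
  lowerJoint : ℕ → U

namespace FrameworkData

variable {ℓ : ℕ} {U : Type*} (F : FrameworkData ℓ U)

/-- The length of the path `P_i`. -/
def barLength (i : ℕ) : ℕ :=
  if Odd ℓ then (ℓ - 3) / 2 else if i ≤ F.m then ℓ / 2 - 1 else ℓ / 2 - 2

/-- The indices `j` for which `b j` may be the apex of a lower tent: `m + 1, …, k` if `ℓ` is odd,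
and `0, …, m` if `ℓ` is even. -/
def lowerSpine : Finset ℕ :=
  if Odd ℓ then Finset.Icc (F.m + 1) F.k else Finset.Icc 0 F.m

/-- `LowerNext j i` says that there is an arc from the `j`-th lower tent-arborescence to `b i`. The
order of the apexes is `b k, b (k - 1), …, b (m + 1)` if `ℓ` is odd, and `b 0, b m, b (m - 1), …, b 1`
if `ℓ` is even. -/
def LowerNext (j i : ℕ) : Prop :=
  if Odd ℓ then F.m + 1 ≤ i ∧ i + 1 ≤ F.k ∧ j = i + 1
  else (1 ≤ i ∧ i + 1 ≤ F.m ∧ j = i + 1) ∨ (1 ≤ F.m ∧ i = F.m ∧ j = 0)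

/-- The apex of the arborescence `S`. -/
def lowerRoot : U := if Odd ℓ then F.b F.k else F.b 0

/-- The indices of the apexes of the upper tents. -/
def upperApexes : Finset ℕ := (Finset.Icc 0 F.m).filter fun i => (F.upperBase i).Nonempty

/-- The indices of the apexes of the lower tents. -/
def lowerApexes : Finset ℕ := F.lowerSpine.filter fun j => (F.lowerBase j).Nonempty

/-- The vertex set of the arborescence `T`. -/
def upperVerts : Set U := {u | ∃ i ≤ F.m, u ∈ (F.upper i).verts}

/-- The vertex set of the arborescence `S`. -/
def lowerVerts : Set U := {u | ∃ j ∈ F.lowerSpine, u ∈ (F.lower j).verts}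

/-- The arcs of the arborescence `T`. -/
def UpperArc (u v : U) : Prop :=
  (∃ i ≤ F.m, (F.upper i).Arc u v) ∨ ∃ i < F.m, u = F.upperJoint i ∧ v = F.a (i + 1)

/-- The arcs of the arborescence `S`. -/
def LowerArc (u v : U) : Prop :=
  (∃ j ∈ F.lowerSpine, (F.lower j).Arc u v) ∨
    ∃ j i, F.LowerNext j i ∧ u = F.lowerJoint j ∧ v = F.b i

/-- `u` and `v` are consecutive on one of the paths `P_1, …, P_k`, with `u` nearer to `a i`. -/
def BarStep (u v : U) : Prop :=
  ∃ i ∈ Finset.Icc 1 F.k, ∃ s < F.barLength i, u = F.bar i s ∧ v = F.bar i (s + 1)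

/-- `t` is a vertex of one of the paths `P_1, …, P_k`. -/
def OnBar (t : U) : Prop :=
  ∃ i ∈ Finset.Icc 1 F.k, ∃ s ≤ F.barLength i, t = F.bar i s

/-- The graph `D`, the union of the transitive closures of `T` and `S` and of the paths
`P_1, …, P_k`: distinct `u`, `v` are adjacent if there is a directed path of `T` or of `S` between
them (in one of the two directions) or they are adjacent in some `P_i`. -/
def closureGraph : SimpleGraph U :=
  SimpleGraph.fromRel fun u v =>
    Relation.ReflTransGen F.UpperArc u v ∨ Relation.ReflTransGen F.LowerArc u v ∨ F.BarStep u v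

end FrameworkData

/-- `ℓ`-frameworks, for `ℓ` odd and for `ℓ` even. -/
structure Framework (ℓ : ℕ) (U : Type*) extends FrameworkData ℓ U where
  m_le_k : m ≤ k
  -- the paths `P_i` and how they meet each other, `T` and `S`
  bar_first : ∀ i ∈ Finset.Icc 1 k, bar i 0 = a i
  bar_last : ∀ i ∈ Finset.Icc 1 k, bar i (toFrameworkData.barLength i) = b i
  bar_inj : ∀ i ∈ Finset.Icc 1 k, ∀ i' ∈ Finset.Icc 1 k,
    ∀ s ≤ toFrameworkData.barLength i, ∀ s' ≤ toFrameworkData.barLength i',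
      bar i s = bar i' s' → i = i' ∧ s = s'
  bar_upper : ∀ i ∈ Finset.Icc 1 k, ∀ s ≤ toFrameworkData.barLength i,
    bar i s ∈ toFrameworkData.upperVerts → s = 0
  bar_lower : ∀ i ∈ Finset.Icc 1 k, ∀ s ≤ toFrameworkData.barLength i,
    bar i s ∈ toFrameworkData.lowerVerts → s = toFrameworkData.barLength i
  upper_lower_disjoint : Disjoint toFrameworkData.upperVerts toFrameworkData.lowerVerts
  vertex_cases : ∀ u : U, u ∈ toFrameworkData.upperVerts ∨ u ∈ toFrameworkData.lowerVerts ∨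
    toFrameworkData.OnBar u
  -- the upper tent-arborescences, pairwise disjoint, and the arcs that join them up
  upper_apex : ∀ i ≤ m, (upper i).apex = a i
  upper_leaves : ∀ i ≤ m, (upper i).leaves = a '' (upperBase i : Set ℕ)
  upper_trivial : ∀ i ≤ m, upperBase i = ∅ → (upper i).verts = {a i}
  upper_disjoint : ∀ i ≤ m, ∀ i' ≤ m, i ≠ i' → Disjoint (upper i).verts (upper i').verts
  upper_joint : ∀ i < m, upperJoint i ∈ (upper i).verts ∧ upperJoint i ∉ (upper i).leaves
  -- the lower tent-arborescences, pairwise disjoint, and the arcs that join them up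
  lower_apex : ∀ j ∈ toFrameworkData.lowerSpine, (lower j).apex = b j
  lower_leaves : ∀ j ∈ toFrameworkData.lowerSpine, (lower j).leaves = b '' (lowerBase j : Set ℕ)
  lower_trivial : ∀ j ∈ toFrameworkData.lowerSpine, lowerBase j = ∅ → (lower j).verts = {b j}
  lower_disjoint : ∀ j ∈ toFrameworkData.lowerSpine, ∀ j' ∈ toFrameworkData.lowerSpine, j ≠ j' →
    Disjoint (lower j).verts (lower j').verts
  lower_joint : ∀ j i, toFrameworkData.LowerNext j i →
    lowerJoint j ∈ (lower j).verts ∧ lowerJoint j ∉ (lower j).leaves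
  -- the bases of the upper tents are intervals that cover `m + 1, …, k`; the tents do not cross;
  -- there is an upper tent with apex `a 0`
  upper_interval : ∀ i ≤ m, (upperBase i : Set ℕ).OrdConnected
  upper_cover : ∀ p, p ∈ Finset.Icc (m + 1) k ↔ ∃ i ≤ m, p ∈ upperBase i
  upper_nested : ∀ i i', i < i' → i' ≤ m → ∀ p ∈ upperBase i, ∀ q ∈ upperBase i', q < p
  upper_zero : (upperBase 0).Nonempty
  -- `ℓ` odd: the bases of the lower tents are intervals that cover `1, …, m`, the tents do not cross
  odd_lower_interval : Odd ℓ → ∀ j ∈ Finset.Icc (m + 1) k, (lowerBase j : Set ℕ).OrdConnected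
  odd_lower_cover : Odd ℓ →
    ∀ p, p ∈ Finset.Icc 1 m ↔ ∃ j ∈ Finset.Icc (m + 1) k, p ∈ lowerBase j
  odd_lower_nested : Odd ℓ → ∀ j ∈ Finset.Icc (m + 1) k, ∀ j' ∈ Finset.Icc (m + 1) k, j < j' →
    ∀ p ∈ lowerBase j, ∀ q ∈ lowerBase j', q < p
  -- `ℓ` odd: interleaving. The innermost upper tent is the one whose apex has the largest index; the
  -- innermost lower tent is the one whose apex has the smallest index.
  odd_upper_interleave : Odd ℓ → ∀ i ∈ toFrameworkData.upperApexes,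
    ¬ (Odd (toFrameworkData.upperApexes.card + toFrameworkData.lowerApexes.card) ∧
        ∀ i' ∈ toFrameworkData.upperApexes, i' ≤ i) →
      ∃ j ∈ toFrameworkData.lowerApexes, IsLeast (upperBase i : Set ℕ) j
  odd_lower_interleave : Odd ℓ → ∀ j ∈ toFrameworkData.lowerApexes,
    ¬ (Even (toFrameworkData.upperApexes.card + toFrameworkData.lowerApexes.card) ∧
        ∀ j' ∈ toFrameworkData.lowerApexes, j ≤ j') →
      ∃ i ∈ toFrameworkData.upperApexes, IsGreatest (lowerBase j : Set ℕ) i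
  -- `ℓ` even: there is an upper tent with apex `a m`; the tent with apex `a i` is paired with the
  -- lower one with apex `b (i + 1)`, or `b 0` if `i = m`, and paired tents are coarboreal
  even_upper_last : Even ℓ → (upperBase m).Nonempty
  even_pairing : Even ℓ → ∀ i ≤ m, lowerBase (if i = m then 0 else i + 1) = upperBase i
  even_coarboreal : Even ℓ → ∀ i ≤ m, (upperBase i).Nonempty →
    Coarboreal (upper i) (lower (if i = m then 0 else i + 1))
      (fun p : upperBase i => a p) (fun p : upperBase i => b p)

/-- The condition on the bag of a leaf `t` of a tent-arborescence with apex `apex`, inside the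
arborescence with vertex set `verts`, arcs `Arc` and apex `root`. Here `ys`, `apex`, `zs`, `t` is the
sequence of vertices of the directed path from `root` to `t`. -/
def TentLeafCondition {U V : Type*} (G : SimpleGraph V) (emb : U → V) (bag : U → List V)
    (verts : Set U) (Arc : U → U → Prop) (root apex t : U) : Prop :=
  ∀ ys zs : List U,
    List.IsChain Arc (ys ++ apex :: (zs ++ [t])) →
    (ys ++ apex :: (zs ++ [t])).head? = some root →
      CompleteTo G {x | x ∈ bag t} {x | ∃ y ∈ ys ++ [apex], x = emb y} ∧
      (∀ u ∈ verts, u ∉ ys ++ apex :: (zs ++ [t]) →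
        AnticompleteTo G {x | x ∈ bag t} {x | x ∈ bag u}) ∧
      Obeys G (bag t) (zs.map emb)

/-- The data exhibiting `G` as a blow-up of the `ℓ`-framework `F`. -/
structure Framework.Blowup {ℓ : ℕ} {U V : Type*} (F : Framework ℓ U) (G : SimpleGraph V) where
  /-- `D` is an induced subgraph of `G`. -/
  emb : F.closureGraph ↪g G
  /-- The ordered cliques `W_t`. -/
  bag : U → List V
  bag_nodup : ∀ t, (bag t).Nodup
  bag_head : ∀ t, (bag t).head? = some (emb t)
  bag_clique : ∀ t, G.IsClique {x | x ∈ bag t}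
  bag_partition : ∀ v, ∃! t, v ∈ bag t
  bag_trivial : ∀ t, ¬ F.OnBar t → bag t = [emb t]
  bag_nonadj : ∀ t t', t ≠ t' → ¬ F.closureGraph.Adj t t' →
    AnticompleteTo G {x | x ∈ bag t} {x | x ∈ bag t'}
  bag_adj : ∀ t t', F.closureGraph.Adj t t' →
    Obeys G (bag t) (bag t') ∧ ∀ x ∈ bag t, ∃ y ∈ bag t', G.Adj x y
  complete_a : ∀ i ∈ Finset.Icc 1 F.k, ∀ j ∈ Finset.Icc 1 F.k, F.closureGraph.Adj (F.a i) (F.a j) →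
    CompleteTo G {x | x ∈ bag (F.a i)} {x | x ∈ bag (F.a j)}
  complete_b : ∀ i ∈ Finset.Icc 1 F.k, ∀ j ∈ Finset.Icc 1 F.k, F.closureGraph.Adj (F.b i) (F.b j) →
    CompleteTo G {x | x ∈ bag (F.b i)} {x | x ∈ bag (F.b j)}
  complete_upper : ∀ t ∈ F.upperVerts, ∀ i ≤ F.m, F.closureGraph.Adj (F.a i) t →
    CompleteTo G {x | x ∈ bag t} {x | x ∈ bag (F.a i)}
  complete_lower : ∀ t ∈ F.lowerVerts, ∀ i ∈ F.lowerSpine, F.closureGraph.Adj (F.b i) t →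
    CompleteTo G {x | x ∈ bag t} {x | x ∈ bag (F.b i)}
  upper_tent : ∀ j ≤ F.m, ∀ t ∈ (F.upper j).leaves,
    TentLeafCondition G emb bag F.upperVerts F.UpperArc (F.a 0) (F.a j) t
  lower_tent : ∀ j ∈ F.lowerSpine, ∀ t ∈ (F.lower j).leaves,
    TentLeafCondition G emb bag F.lowerVerts F.LowerArc F.lowerRoot (F.b j) t

/-- `G` is a blow-up of the `ℓ`-framework `F`. -/
def Framework.IsBlowup {ℓ : ℕ} {U V : Type*} (F : Framework ℓ U) (G : SimpleGraph V) : Prop :=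
  Nonempty (F.Blowup G)

/-! A blow-up is partitioned into cliques, its bags, and of two vertices of one bag one dominates
the other outside the bag. A hole with two vertices in a bag would contain a triangle, so it meets
each bag at most once (`injective_comp_of_dominated`) and projects injectively to a cycle `K` on the
set of indices of the bags. For a blow-up of an ℓ-cycle, `K` lives on ℤ/ℓ and joins only consecutive
elements, so it goes all the way round.

For a framework, `K` is a cycle in the graph `D`, not necessarily induced, because adjacency between
the bag of a leaf and another bag is only partly prescribed. `TentTree.Compat` records the
adjacencies that are forced. They imply that a vertex of `K` with both neighbours in the upper
arborescence is an ancestor of both (`Mid.lt`), so two such vertices are never adjacent. Hence `K`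
crosses an arborescence in pieces of one shape only: two ends of paths `P_i`, adjacent or with a
single vertex between them. The paths contained in `K` are thus paired off twice, by a pairing `f`
in the upper arborescence and a pairing `g` in the lower one.

The main point is that `f` and `g` share a pair; then `K` consists of just two paths and at most one
further vertex at each end. For ℓ odd, every path ends in an apex above or below, apexes on one side
are pairwise adjacent, and a small counting argument suffices (`exists_eq_of_exchange`). For ℓ even,
the remaining difficulty is when all ends are leaves: both pairings then preserve the last tent that
occurs, and in the common tree of that tent and its partner the pairs span subtrees, to which a
Helly-type argument applies (`IsTree.exists_common_pair`).

The length is then read off from which ends are adjacent. For ℓ odd exactly one of the two end pairs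
is adjacent, which is the content of the interleaving condition (`lt_iff_le_of_interleaved`); for ℓ
even the different path lengths compensate. -/

/-! ### Holes as cycles, and their projection along a partition into cliques. -/

/-- `K` is a cycle of length `n` with vertex set `H`, without chords between the two neighbours of
a vertex, and isolated vertices outside `H`. -/
structure CycleOn {α : Type*} (K : SimpleGraph α) (H : Set α) (n : ℕ) : Prop where
  four_le : 4 ≤ n
  mem : ∀ {u v}, K.Adj u v → u ∈ H
  two : ∀ u ∈ H, ∃ y z, y ≠ z ∧ ¬ K.Adj y z ∧ ∀ w, K.Adj u w ↔ w = y ∨ w = z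
  conn : ∀ Z ⊆ H, Z.Nonempty → (∀ u ∈ Z, ∀ v, K.Adj u v → v ∈ Z) → Z = H
  card : H.ncard = n

theorem cycleGraph_two_neighbors {n : ℕ} (hn : 4 ≤ n) (i : Fin n) :
    ∃ y z, y ≠ z ∧ ¬ (SimpleGraph.cycleGraph n).Adj y z ∧
      ∀ w, (SimpleGraph.cycleGraph n).Adj i w ↔ w = y ∨ w = z := by
  obtain ⟨n, rfl⟩ : ∃ k, n = k + 2 := ⟨n - 2, by omega⟩
  -- If `i + 1` and `i - 1` were equal or adjacent, then 2, 1 or 3 would vanish modulo the length,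
  -- which is at least 4.
  refine ⟨i + 1, i - 1, ?_, ?_, ?_⟩
  · intro h
    have h2 : (1 : Fin (n + 2)) + 1 = 0 := by
      have : i + 1 - (i - 1) = 0 := sub_eq_zero.2 h
      rw [← this]; abel
    have := congrArg Fin.val h2
    rw [Fin.val_add] at this
    simp at this
    rw [Nat.mod_eq_of_lt (by omega)] at this
    omega
  · rw [SimpleGraph.cycleGraph_adj]
    rintro (h | h)
    · have h2 : (1 : Fin (n + 2)) = 0 := by
        have : i + 1 - (i - 1) - 1 = 0 := sub_eq_zero.2 h
        rw [← this]; abel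
      simpa using congrArg Fin.val h2
    · have h2 : (1 : Fin (n + 2)) + 1 + 1 = 0 := by
        have : 1 - (i - 1 - (i + 1)) = 0 := sub_eq_zero.2 h.symm
        rw [← this]; abel
      have := congrArg Fin.val h2
      simp only [Fin.val_add] at this
      simp at this
      rw [Nat.mod_eq_of_lt (by omega)] at this
      omega
  · intro w
    rw [SimpleGraph.cycleGraph_adj]
    constructor
    · rintro (h | h)
      · right; rw [← h]; abel
      · left; rw [← h]; abel
    · rintro (rfl | rfl)
      · right; abel
      · left; abel

theorem cycleOn_map {α : Type*} {n : ℕ} (hn : 4 ≤ n) (f : Fin n ↪ α) :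
    CycleOn ((SimpleGraph.cycleGraph n).map f) (Set.range f) n where
  four_le := hn
  mem := by
    rintro u v ⟨-, i, j, h, rfl, rfl⟩
    exact ⟨i, rfl⟩
  two := by
    rintro _ ⟨i, rfl⟩
    obtain ⟨y, z, hyz, hnadj, h⟩ := cycleGraph_two_neighbors hn i
    refine ⟨f y, f z, fun e => hyz (f.injective e), ?_, ?_⟩
    · rwa [SimpleGraph.map_adj_apply]
    · intro w
      constructor
      · rintro ⟨-, a, b, hab, ha, rfl⟩
        rw [f.injective ha] at hab
        rcases (h b).1 hab with rfl | rfl <;> simp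
      · rintro (rfl | rfl)
        · exact (SimpleGraph.map_adj_apply ..).2 ((h y).2 (Or.inl rfl))
        · exact (SimpleGraph.map_adj_apply ..).2 ((h z).2 (Or.inr rfl))
  conn := by
    intro Z hZ ⟨z, hz⟩ hcl
    refine Set.Subset.antisymm hZ ?_
    obtain ⟨i, rfl⟩ := hZ hz
    rintro _ ⟨j, rfl⟩
    have hr : (SimpleGraph.cycleGraph n).Reachable i j := SimpleGraph.cycleGraph_preconnected i j
    obtain ⟨w⟩ := hr
    induction w with
    | nil => exact hz
    | cons h p ih => exact ih (hcl _ hz _ ((SimpleGraph.map_adj_apply ..).2 h))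
  card := by
    rw [← Set.image_univ, Set.ncard_image_of_injective _ f.injective, Set.ncard_univ,
      Nat.card_eq_fintype_card, Fintype.card_fin]

namespace CycleOn

variable {α : Type*} {K : SimpleGraph α} {H : Set α} {n : ℕ}

theorem mem_right (h : CycleOn K H n) {u v : α} (huv : K.Adj u v) : v ∈ H := h.mem huv.symm

theorem finite (h : CycleOn K H n) : H.Finite :=
  Set.finite_of_ncard_pos (by have := h.card; have := h.four_le; omega)

theorem nonempty (h : CycleOn K H n) : H.Nonempty := by
  rw [← Set.ncard_pos h.finite, h.card]
  have := h.four_le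
  omega

/-- A vertex is adjacent to at most two vertices. -/
theorem eq_or_eq (h : CycleOn K H n) {u x y z : α} (hxy : x ≠ y) (hx : K.Adj u x) (hy : K.Adj u y)
    (hz : K.Adj u z) : z = x ∨ z = y := by
  obtain ⟨a, b, -, -, hab⟩ := h.two u (h.mem hx)
  rw [hab] at hx hy hz
  grind

theorem not_adj (h : CycleOn K H n) {u x y : α} (hx : K.Adj u x) (hy : K.Adj u y) :
    ¬ K.Adj x y := by
  obtain ⟨a, b, -, hn, hab⟩ := h.two u (h.mem hx)
  rw [hab] at hx hy
  rcases hx with rfl | rfl <;> rcases hy with rfl | rfl <;> first | exact K.irrefl | exact hn | skip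
  exact fun e => hn e.symm

theorem exists_other (h : CycleOn K H n) {u x : α} (hx : K.Adj u x) : ∃ y, K.Adj u y ∧ y ≠ x := by
  obtain ⟨a, b, hab', hn, hab⟩ := h.two u (h.mem hx)
  by_cases hxa : x = a
  · exact ⟨b, (hab b).2 (Or.inr rfl), fun e => hab' (hxa ▸ e.symm)⟩
  · exact ⟨a, (hab a).2 (Or.inl rfl), fun e => hxa e.symm⟩

theorem exists_two (h : CycleOn K H n) {u : α} (hu : u ∈ H) :
    ∃ y z, y ≠ z ∧ K.Adj u y ∧ K.Adj u z := by
  obtain ⟨y, z, hyz, -, hh⟩ := h.two u hu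
  exact ⟨y, z, hyz, (hh y).2 (Or.inl rfl), (hh z).2 (Or.inr rfl)⟩

end CycleOn

/-- If the sets of a partition into cliques are such that, of any two members of the same set, one
dominates the other, then each set contains at most one vertex of each hole. -/
theorem injective_comp_of_dominated {V U : Type*} {G : SimpleGraph V} {n : ℕ} (hn : 4 ≤ n)
    (c : SimpleGraph.cycleGraph n ↪g G) (τ : V → U)
    (hclique : ∀ x y, τ x = τ y → x ≠ y → G.Adj x y)
    (hdom : ∀ x y, τ x = τ y → (∀ w, τ w ≠ τ x → G.Adj y w → G.Adj x w) ∨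
      (∀ w, τ w ≠ τ x → G.Adj x w → G.Adj y w)) :
    Function.Injective (τ ∘ c) := by
  -- The vertices `c i`, `c j` lie in one clique. The other neighbour of `j` is adjacent to `i`,
  -- either inside the clique or by domination, and closes a triangle.
  have key : ∀ i j, i ≠ j → τ (c i) = τ (c j) →
      ¬ (∀ w, τ w ≠ τ (c i) → G.Adj (c j) w → G.Adj (c i) w) := by
    intro i j hij he hd
    have hadj : (SimpleGraph.cycleGraph n).Adj j i :=
      c.map_adj_iff.1 (hclique _ _ he.symm (fun e => hij (c.injective e.symm)))
    have C := cycleOn_map hn (Function.Embedding.refl (Fin n))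
    rw [Function.Embedding.coe_refl, SimpleGraph.map_id] at C
    obtain ⟨w, hw, hwi⟩ := C.exists_other hadj
    apply C.not_adj hadj hw
    rw [← c.map_adj_iff]
    by_cases hτ : τ (c w) = τ (c i)
    · exact hclique _ _ hτ.symm (fun e => hwi (c.injective e.symm))
    · exact hd _ hτ (c.map_adj_iff.2 hw)
  intro i j he
  by_contra hij
  rcases hdom _ _ he with h | h
  · exact key i j hij he h
  · exact key j i (Ne.symm hij) he.symm (fun w hw => h w (by rwa [show τ (c i) = τ (c j) from he]))

/-! ### Blow-ups of cycles. -/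

/-- The half-graph condition on `W i` against the union of its two neighbouring cliques says
precisely that any two vertices of `W i` are comparable by domination. -/
theorem IsCycleBlowup.isHoled {V : Type*} {G : SimpleGraph V} {ℓ : ℕ} (hℓ : 5 ≤ ℓ)
    (h : IsCycleBlowup G ℓ) : IsHoled G ℓ := by
  obtain ⟨W, hpart, hW, -, hadj, hhalf⟩ := h
  rintro n hn ⟨c⟩
  have : NeZero ℓ := ⟨by omega⟩
  choose τ hτ hτu using hpart
  have hτiff : ∀ v i, v ∈ W i ↔ τ v = i :=
    fun v i => ⟨fun h => (hτu v i h).symm, fun h => h ▸ hτ v⟩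
  have hside : ∀ x w, τ w ≠ τ x → G.Adj x w → w ∈ W (τ x + 1) ∪ W (τ x - 1) := by
    intro x w hne ha
    rcases hadj (τ x) (τ w) (Ne.symm hne) ⟨x, hτ x, w, hτ w, ha⟩ with h | h
    · left; rw [← h]; exact hτ w
    · right; rw [← h]; exact hτ w
  have hinj : Function.Injective (τ ∘ c) := by
    refine injective_comp_of_dominated hn c τ ?_ ?_
    · intro x y hxy hne
      exact (hW (τ x)).2 (hτ x) ((hτiff _ _).2 hxy.symm) hne
    · intro x y hxy
      by_contra hcon
      push Not at hcon
      obtain ⟨⟨w, hw, hyw, hxw⟩, ⟨w', hw', hxw', hyw'⟩⟩ := hcon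
      rcases hhalf (τ x) x (hτ x) y ((hτiff _ _).2 hxy.symm) w' (hside x w' hw' hxw') w
        (hxy ▸ hside y w (hxy ▸ hw) hyw) hxw' hyw with h | h
      · exact hxw h
      · exact hyw' h
  have C := cycleOn_map hn ⟨τ ∘ c, hinj⟩
  rw [Function.Embedding.coeFn_mk] at C
  have hK : ∀ i j, ((SimpleGraph.cycleGraph n).map (τ ∘ c)).Adj i j → j = i + 1 ∨ j = i - 1 := by
    rintro _ _ ⟨hne, a, b, hab, rfl, rfl⟩
    exact hadj _ _ hne ⟨c a, hτ _, c b, hτ _, c.map_adj_iff.2 hab⟩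
  -- The two distinct neighbours of `i` lie in {i + 1, i - 1}, so one of them is `i + 1`.
  have hstep : ∀ i ∈ Set.range (τ ∘ c), i + 1 ∈ Set.range (τ ∘ c) := by
    intro i hi
    obtain ⟨y, z, hyz, hy, hz⟩ := C.exists_two hi
    have h1 := hK _ _ hy
    have h2 := hK _ _ hz
    rcases h1 with h1 | h1
    · exact h1 ▸ C.mem_right hy
    · rcases h2 with h2 | h2
      · exact h2 ▸ C.mem_right hz
      · exact absurd (h1.trans h2.symm) hyz
  have hall : Set.range (τ ∘ c) = Set.univ := by
    obtain ⟨i, hi⟩ : (Set.range (τ ∘ c)).Nonempty := C.nonempty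
    have : ∀ k : ℕ, i + k ∈ Set.range (τ ∘ c) := by
      intro k
      induction k with
      | zero => simpa using hi
      | succ k ih => simpa [add_assoc] using hstep _ ih
    refine Set.eq_univ_of_forall fun j => ?_
    have hj := this (j - i).val
    rwa [ZMod.natCast_zmod_val, add_sub_cancel] at hj
  have hcard : (Set.range (τ ∘ c)).ncard = n := C.card
  rw [hall, Set.ncard_univ, Nat.card_zmod] at hcard
  exact hcard.symm

/-! ### Subtrees of a rooted tree. -/

namespace SimpleGraph

variable {L : Type*} {R : SimpleGraph L}

/-- In a tree with root `x₀`, the path from a vertex `p` of a subtree to the root leaves the subtree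
at its vertex `r` closest to the root. -/
theorem IsTree.exists_path_via_nearest (x₀ : L) (hR : R.IsTree) {A : Set L}
    (hA : (R.induce A).Connected) {p r : L} (hp : p ∈ A) (hr : r ∈ A)
    (hmin : ∀ x ∈ A, R.dist r x₀ ≤ R.dist x x₀) :
    ∃ (q₁ : R.Walk p r) (q₂ : R.Walk r x₀), (∀ x ∈ q₁.support, x ∈ A) ∧
      q₂.length = R.dist r x₀ ∧ (q₁.append q₂).IsPath := by
  classical
  obtain ⟨w⟩ := hA.preconnected ⟨p, hp⟩ ⟨r, hr⟩
  let q₁ : R.Walk p r := w.toPath.1.map (Embedding.induce A).toHom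
  have hq₁ : q₁.IsPath := w.toPath.2.map Subtype.val_injective
  obtain ⟨q₂, hq₂⟩ := (hR.1.preconnected r x₀).exists_walk_length_eq_dist
  have hq₂p : q₂.IsPath := Walk.isPath_of_length_eq_dist q₂ hq₂
  have hsup : ∀ x ∈ q₁.support, x ∈ A := by
    intro x hx
    rw [show q₁.support = _ from Walk.support_map _ _, List.mem_map] at hx
    obtain ⟨y, -, rfl⟩ := hx
    exact y.2
  refine ⟨q₁, q₂, hsup, hq₂, ?_⟩
  -- A second common vertex would belong to the subtree and, being further along a shortest path to
  -- the root, be closer to the root than `r`.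
  have hdis : ∀ x ∈ q₁.support, x ∈ q₂.support → x = r := by
    intro x hx1 hx2
    by_contra hne
    have h1 := hmin x (hsup x hx1)
    have h2 := congrArg Walk.length (q₂.take_spec hx2)
    rw [Walk.length_append] at h2
    have h3 := dist_le (q₂.dropUntil x hx2)
    have h4 : 0 < (q₂.takeUntil x hx2).length := by
      rw [Nat.pos_iff_ne_zero]
      intro h0
      exact hne (Walk.eq_of_length_eq_zero h0).symm
    omega
  rw [Walk.isPath_def, Walk.support_append, List.nodup_append]
  refine ⟨hq₁.support_nodup, hq₂p.support_nodup.tail, ?_⟩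
  rintro x hx y hy rfl
  have := hdis x hx (List.mem_of_mem_tail hy)
  subst this
  have hnd := hq₂p.support_nodup
  rw [← Walk.cons_tail_support, List.nodup_cons] at hnd
  exact hnd.1 hy

/-- If two subtrees of a rooted tree intersect, then the root of the one that is farther from the
root of the tree lies in both. -/
theorem IsTree.nearest_mem_of_inter (x₀ : L) (hR : R.IsTree) {A B : Set L}
    (hA : (R.induce A).Connected) (hB : (R.induce B).Connected) {p r s : L} (hpA : p ∈ A)
    (hpB : p ∈ B) (hr : r ∈ A) (hrmin : ∀ x ∈ A, R.dist r x₀ ≤ R.dist x x₀) (hs : s ∈ B)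
    (hsmin : ∀ x ∈ B, R.dist s x₀ ≤ R.dist x x₀) (hsr : R.dist s x₀ ≤ R.dist r x₀) : r ∈ B := by
  obtain ⟨q₁, q₂, -, hq2, hq⟩ := hR.exists_path_via_nearest x₀ hA hpA hr hrmin
  obtain ⟨q₁', q₂', hq1', hq2', hq'⟩ := hR.exists_path_via_nearest x₀ hB hpB hs hsmin
  -- The unique path from `p` to the root passes through both `r` and `s`. Since `r` is at least as
  -- far from the root, it is not met after `s`, so it is on the part that stays in `B`.
  have heq : q₁.append q₂ = q₁'.append q₂' :=
    (hR.existsUnique_path p x₀).unique hq hq'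
  have hlen := congrArg Walk.length heq
  rw [Walk.length_append, Walk.length_append] at hlen
  have hr1 : (q₁.append q₂).getVert q₁.length = r := by
    rw [Walk.getVert_append]; simp
  rw [heq, Walk.getVert_append] at hr1
  split_ifs at hr1 with h
  · rw [← hr1]
    exact hq1' _ (Walk.getVert_mem_support _ _)
  · have : q₁.length = q₁'.length := by omega
    rw [this, Nat.sub_self, Walk.getVert_zero] at hr1
    exact hr1 ▸ hs

/-- Two fixed-point-free pairings `f`, `g` of a set `Z` of vertices of a tree, such that the pairs of
`f` are contained in pairwise disjoint subtrees, and so are the pairs of `g`, have a common pair. -/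
theorem IsTree.exists_common_pair [Finite L] (hR : R.IsTree) {Z : Set L} (hZ : Z.Nonempty)
    (f g : L → L) (hf : ∀ p ∈ Z, f p ∈ Z ∧ f p ≠ p) (hg : ∀ p ∈ Z, g p ∈ Z ∧ g p ≠ p)
    (A B : L → Set L)
    (hA : ∀ p ∈ Z, (R.induce (A p)).Connected ∧ p ∈ A p ∧ f p ∈ A p)
    (hB : ∀ p ∈ Z, (R.induce (B p)).Connected ∧ p ∈ B p ∧ g p ∈ B p)
    (hAdisj : ∀ p ∈ Z, ∀ q ∈ Z, (A p ∩ A q).Nonempty → q = p ∨ q = f p)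
    (hBdisj : ∀ p ∈ Z, ∀ q ∈ Z, (B p ∩ B q).Nonempty → q = p ∨ q = g p) :
    ∃ p ∈ Z, f p = g p := by
  obtain ⟨z, hz⟩ := hZ
  have hmin : ∀ S : Set L, S.Nonempty → ∃ r ∈ S, ∀ x ∈ S, R.dist r z ≤ R.dist x z :=
    fun S hS => Set.exists_min_image S (fun x => R.dist x z) S.toFinite hS
  have hrA : ∀ p : Z, ∃ r ∈ A p, ∀ x ∈ A p, R.dist r z ≤ R.dist x z :=
    fun p => hmin _ ⟨p, (hA p p.2).2.1⟩
  have hrB : ∀ p : Z, ∃ r ∈ B p, ∀ x ∈ B p, R.dist r z ≤ R.dist x z :=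
    fun p => hmin _ ⟨p, (hB p p.2).2.1⟩
  choose ra hra hramin using hrA
  choose rb hrb hrbmin using hrB
  have : Nonempty Z := ⟨⟨z, hz⟩⟩
  obtain ⟨p, hp⟩ := Finite.exists_max fun p : Z => R.dist (ra p) z
  obtain ⟨q, hq⟩ := Finite.exists_max fun p : Z => R.dist (rb p) z
  -- Among all subtrees of both families, take one whose root is farthest from `z`. If it is `A p`,
  -- its root lies in `B p` and in `B (f p)`, since these meet `A p` at `p` and at `f p`;
  -- disjointness of the `B`'s then gives `f p = g p`.
  rcases le_total (R.dist (rb q) z) (R.dist (ra p) z) with hle | hle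
  · let p' : Z := ⟨f p, (hf p p.2).1⟩
    have h1 : ra p ∈ B p := hR.nearest_mem_of_inter z (hA p p.2).1 (hB p p.2).1 (hA p p.2).2.1
      (hB p p.2).2.1 (hra p) (hramin p) (hrb p) (hrbmin p) ((hq p).trans hle)
    have h2 : ra p ∈ B p' := hR.nearest_mem_of_inter z (hA p p.2).1 (hB p' p'.2).1
      (hA p p.2).2.2 (hB p' p'.2).2.1 (hra p) (hramin p) (hrb p') (hrbmin p') ((hq p').trans hle)
    rcases hBdisj p p.2 p' p'.2 ⟨_, h1, h2⟩ with h | h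
    · exact absurd h (hf p p.2).2
    · exact ⟨p, p.2, h⟩
  · let q' : Z := ⟨g q, (hg q q.2).1⟩
    have h1 : rb q ∈ A q := hR.nearest_mem_of_inter z (hB q q.2).1 (hA q q.2).1 (hB q q.2).2.1
      (hA q q.2).2.1 (hrb q) (hrbmin q) (hra q) (hramin q) ((hp q).trans hle)
    have h2 : rb q ∈ A q' := hR.nearest_mem_of_inter z (hB q q.2).1 (hA q' q'.2).1
      (hB q q.2).2.2 (hA q' q'.2).2.1 (hrb q) (hrbmin q) (hra q') (hramin q') ((hp q').trans hle)
    rcases hAdisj q q.2 q' q'.2 ⟨_, h1, h2⟩ with h | h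
    · exact absurd h (hg q q.2).2
    · exact ⟨q, q.2, h.symm⟩

end SimpleGraph

/-! ### The ancestor order of an arborescence assembled from tents. -/

/-- A sequence of pairwise disjoint arborescences `tent 0, …, tent last`, joined up by arcs from the
vertices `joint c` of `tent c` that are not leaves to the apexes of `tent (c + 1)`. -/
structure TentTree (U : Type*) where
  last : ℕ
  tent : ℕ → Arborescence U
  joint : ℕ → U
  disjoint : ∀ c ≤ last, ∀ c' ≤ last, c ≠ c' → Disjoint (tent c).verts (tent c').verts
  joint_mem : ∀ c < last, joint c ∈ (tent c).verts
  joint_not_leaf : ∀ c < last, joint c ∉ (tent c).leaves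

namespace TentTree

open Relation

variable {U : Type*} (T : TentTree U)

/-- The apex of `tent c`. -/
def apex (c : ℕ) : U := (T.tent c).apex

/-- The vertices of the whole arborescence. -/
def verts : Set U := {u | ∃ c ≤ T.last, u ∈ (T.tent c).verts}

/-- The arcs of the whole arborescence. -/
def Arc (u v : U) : Prop :=
  (∃ c ≤ T.last, (T.tent c).Arc u v) ∨ ∃ c < T.last, u = T.joint c ∧ v = T.apex (c + 1)

/-- There is a directed path from `u` to `v`. -/
def Le (u v : U) : Prop := ReflTransGen T.Arc u v

/-- `t` is a leaf of `tent c`. -/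
def IsLeaf (c : ℕ) (t : U) : Prop := c ≤ T.last ∧ t ∈ (T.tent c).leaves

variable {T}

theorem apex_mem {c : ℕ} : T.apex c ∈ (T.tent c).verts := (T.tent c).apex_mem

theorem IsLeaf.mem {c : ℕ} {t : U} (h : T.IsLeaf c t) : t ∈ (T.tent c).verts := h.2.1

theorem mem_verts {c : ℕ} (hc : c ≤ T.last) {u : U} (hu : u ∈ (T.tent c).verts) : u ∈ T.verts :=
  ⟨c, hc, hu⟩

theorem eq_of_mem {c c' : ℕ} (hc : c ≤ T.last) (hc' : c' ≤ T.last) {u : U}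
    (h : u ∈ (T.tent c).verts) (h' : u ∈ (T.tent c').verts) : c = c' := by
  by_contra hne
  exact Set.disjoint_left.1 (T.disjoint c hc c' hc' hne) h h'

theorem Arc.mem {u v : U} (h : T.Arc u v) : u ∈ T.verts ∧ v ∈ T.verts := by
  rcases h with ⟨c, hc, h⟩ | ⟨c, hc, rfl, rfl⟩
  · exact ⟨mem_verts hc ((T.tent c).arc_mem _ _ h).1, mem_verts hc ((T.tent c).arc_mem _ _ h).2⟩
  · exact ⟨mem_verts hc.le (T.joint_mem c hc), mem_verts hc apex_mem⟩

theorem Arc.eq_of_head {u v w : U} (hu : T.Arc u w) (hv : T.Arc v w) : u = v := by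
  rcases hu with ⟨c, hc, h⟩ | ⟨c, hc, rfl, rfl⟩
  · rcases hv with ⟨c', hc', h'⟩ | ⟨c', hc', rfl, rfl⟩
    · obtain rfl := eq_of_mem hc hc' ((T.tent c).arc_mem _ _ h).2 ((T.tent c').arc_mem _ _ h').2
      exact (T.tent c).arc_head_unique _ _ _ h h'
    · obtain rfl := eq_of_mem hc hc' ((T.tent c).arc_mem _ _ h).2 apex_mem
      exact absurd h ((T.tent _).not_arc_apex _)
  · rcases hv with ⟨c', hc', h'⟩ | ⟨c', hc', rfl, h'⟩
    · obtain rfl := eq_of_mem hc' hc ((T.tent c').arc_mem _ _ h').2 apex_mem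
      exact absurd h' ((T.tent _).not_arc_apex _)
    · have := eq_of_mem hc hc' apex_mem (h' ▸ apex_mem)
      rw [Nat.succ_injective this]

theorem not_arc_apex_zero (u : U) : ¬ T.Arc u (T.apex 0) := by
  rintro (⟨c, hc, h⟩ | ⟨c, hc, rfl, h⟩)
  · obtain rfl := eq_of_mem hc (Nat.zero_le _) ((T.tent c).arc_mem _ _ h).2 apex_mem
    exact (T.tent _).not_arc_apex _ h
  · have := eq_of_mem (Nat.zero_le _) hc apex_mem (h ▸ apex_mem)
    omega

theorem le_of_tent {c : ℕ} (hc : c ≤ T.last) {u v : U} (h : ReflTransGen (T.tent c).Arc u v) :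
    T.Le u v :=
  ReflTransGen.lift (p := T.Arc) id (fun _ _ h => Or.inl ⟨c, hc, h⟩) _ _ h

theorem apex_le {c : ℕ} (hc : c ≤ T.last) {u : U} (hu : u ∈ (T.tent c).verts) :
    T.Le (T.apex c) u :=
  le_of_tent hc ((T.tent c).reachable u hu)

theorem apex_le_apex {c c' : ℕ} (h : c ≤ c') (hc' : c' ≤ T.last) : T.Le (T.apex c) (T.apex c') := by
  induction c', h using Nat.le_induction with
  | base => exact ReflTransGen.refl
  | succ d hd ih =>
    exact ((ih (by omega)).trans (apex_le (by omega) (T.joint_mem d (by omega)))).tail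
      (Or.inr ⟨d, by omega, rfl, rfl⟩)

theorem apex_zero_le {u : U} (hu : u ∈ T.verts) : T.Le (T.apex 0) u := by
  obtain ⟨c, hc, hu⟩ := hu
  exact (apex_le_apex (Nat.zero_le c) hc).trans (apex_le hc hu)

theorem Le.trans {u v w : U} (h : T.Le u v) (h' : T.Le v w) : T.Le u w := ReflTransGen.trans h h'

theorem Le.mem_of_ne {u v : U} (h : T.Le u v) (hne : u ≠ v) : u ∈ T.verts ∧ v ∈ T.verts := by
  constructor
  · rcases ReflTransGen.cases_head h with rfl | ⟨w, hw, -⟩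
    · exact absurd rfl hne
    · exact hw.mem.1
  · rcases ReflTransGen.cases_tail h with rfl | ⟨w, -, hw⟩
    · exact absurd rfl hne
    · exact hw.mem.2

/-- No two arcs share a head, so the ancestors of a vertex form a chain. -/
theorem Le.total {u v w : U} (hu : T.Le u w) (hv : T.Le v w) : T.Le u v ∨ T.Le v u := by
  rw [Le, ← reflTransGen_swap] at hu hv
  have := ReflTransGen.total_of_right_unique (r := Function.swap T.Arc)
    (fun _ _ _ h h' => Arc.eq_of_head h h') hu hv
  exact (this.imp reflTransGen_swap.1 reflTransGen_swap.1).symm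

/-- Since tails are unique, a directed cycle through a vertex also passes through its predecessor.
Pulled back along the path from the root, it would reach the root, which has no incoming arc. -/
theorem not_transGen_self (u : U) : ¬ TransGen T.Arc u u := by
  intro h
  have hu : u ∈ T.verts := by
    obtain ⟨w, -, hw⟩ := TransGen.tail'_iff.1 h
    exact hw.mem.2
  have h0 := apex_zero_le hu
  clear hu
  induction h0 with
  | refl =>
    obtain ⟨w, -, hw⟩ := TransGen.tail'_iff.1 h
    exact not_arc_apex_zero _ hw
  | tail _ hvw ih =>
    obtain ⟨w', hw', hw⟩ := TransGen.tail'_iff.1 h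
    obtain rfl := Arc.eq_of_head hvw hw
    exact ih (TransGen.head' hw hw')

theorem Le.antisymm {u v : U} (h : T.Le u v) (h' : T.Le v u) : u = v := by
  by_contra hne
  rcases reflTransGen_iff_eq_or_transGen.1 h with e | h1
  · exact hne e.symm
  · exact not_transGen_self _ (h1.trans_left h')

/-- The arcs go from a tent to the same or a later tent. -/
theorem Le.index_le {u v : U} (h : T.Le u v) {c c' : ℕ} (hc : c ≤ T.last) (hc' : c' ≤ T.last)
    (hu : u ∈ (T.tent c).verts) (hv : v ∈ (T.tent c').verts) : c ≤ c' := by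
  induction h generalizing c' with
  | refl => exact (eq_of_mem hc hc' hu hv).le
  | tail _ hvw ih =>
    rcases hvw with ⟨d, hd, h⟩ | ⟨d, hd, rfl, rfl⟩
    · obtain rfl := eq_of_mem hd hc' ((T.tent d).arc_mem _ _ h).2 hv
      exact ih hd ((T.tent d).arc_mem _ _ h).1
    · obtain rfl := eq_of_mem hd hc' apex_mem hv
      exact (ih hd.le (T.joint_mem d hd)).trans (Nat.le_succ d)

/-- A path can enter a later tent only through its apex. -/
theorem Le.le_apex {u v : U} (h : T.Le u v) {c c' : ℕ} (hc : c ≤ T.last) (hc' : c' ≤ T.last)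
    (hu : u ∈ (T.tent c).verts) (hv : v ∈ (T.tent c').verts) (hcc : c < c') :
    T.Le u (T.apex c') := by
  rcases h.total (apex_le hc' hv) with h1 | h1
  · exact h1
  · exact absurd (h1.index_le hc' hc apex_mem hu) (by omega)

/-- From a vertex with a descendant in some later tent one reaches the very next apex, and from
there all later ones. -/
theorem Le.le_apex_of_lt {u v : U} (h : T.Le u v) {c c' d : ℕ} (hc : c ≤ T.last) (hc' : c' ≤ T.last)
    (hd : d ≤ T.last) (hu : u ∈ (T.tent c).verts) (hv : v ∈ (T.tent c').verts) (hcc : c < c')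
    (hcd : c < d) : T.Le u (T.apex d) := by
  have h1 := h.le_apex hc hc' hu hv hcc
  have h2 : T.Le u (T.apex (c + 1)) := by
    rcases h1.total (apex_le_apex (c := c + 1) hcc hc') with h3 | h3
    · exact h3
    · exact absurd (h3.index_le (by omega) hc apex_mem hu) (by omega)
  exact h2.trans (apex_le_apex hcd hd)

theorem apex_le_iff {c c' : ℕ} (hc : c ≤ T.last) (hc' : c' ≤ T.last) {u : U}
    (hu : u ∈ (T.tent c').verts) : T.Le (T.apex c) u ↔ c ≤ c' :=
  ⟨fun h => h.index_le hc hc' apex_mem hu, fun h => (apex_le_apex h hc').trans (apex_le hc' hu)⟩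

theorem IsLeaf.not_arc {c : ℕ} {t : U} (h : T.IsLeaf c t) (w : U) : ¬ T.Arc t w := by
  rintro (⟨d, hd, h'⟩ | ⟨d, hd, rfl, -⟩)
  · obtain rfl := eq_of_mem h.1 hd h.mem ((T.tent d).arc_mem _ _ h').1
    exact h.2.2.2 _ h'
  · obtain rfl := eq_of_mem h.1 hd.le h.mem (T.joint_mem d hd)
    exact T.joint_not_leaf _ hd h.2

theorem IsLeaf.eq_of_le {c : ℕ} {t : U} (h : T.IsLeaf c t) {w : U} (hw : T.Le t w) : w = t := by
  rcases ReflTransGen.cases_head hw with rfl | ⟨x, hx, -⟩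
  · rfl
  · exact absurd hx (h.not_arc _)

theorem IsLeaf.ne_apex {c c' : ℕ} {t : U} (h : T.IsLeaf c t) (hc' : c' ≤ T.last) :
    t ≠ T.apex c' := by
  rintro rfl
  obtain rfl := eq_of_mem h.1 hc' h.mem apex_mem
  exact h.2.2.1 rfl

theorem Le.tent_of_mem {u v : U} (h : T.Le u v) {c : ℕ} (hc : c ≤ T.last)
    (hu : u ∈ (T.tent c).verts) (hv : v ∈ (T.tent c).verts) : ReflTransGen (T.tent c).Arc u v := by
  induction h with
  | refl => exact ReflTransGen.refl
  | @tail w x huw hwx ih =>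
    rcases hwx with ⟨d, hd, h⟩ | ⟨d, hd, rfl, rfl⟩
    · obtain rfl := eq_of_mem hd hc ((T.tent d).arc_mem _ _ h).2 hv
      exact (ih ((T.tent d).arc_mem _ _ h).1).tail h
    · obtain rfl := eq_of_mem hd hc apex_mem hv
      have := Le.index_le huw hd hd.le hu (T.joint_mem d hd)
      omega

/-- If a tent lives in a tree, then the set of its leaves below any vertex of the whole arborescence
is empty or the vertex set of a subtree. -/
theorem connected_of_livesIn {L : Type*} {leaf : L → U} {R : SimpleGraph L} {c : ℕ}
    (hc : c ≤ T.last) (hleaf : ∀ x, leaf x ∈ (T.tent c).verts) (h : (T.tent c).LivesIn leaf R)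
    {v : U} {x : L} (hx : T.Le v (leaf x)) : (R.induce {x | T.Le v (leaf x)}).Connected := by
  by_cases hv : v ∈ (T.tent c).verts
  · have : {x | T.Le v (leaf x)} = {x | ReflTransGen (T.tent c).Arc v (leaf x)} := by
      ext y
      exact ⟨fun hy => hy.tent_of_mem hc hv (hleaf y), fun hy => le_of_tent hc hy⟩
    rw [this]
    exact h v hv
  · have hvv : v ∈ T.verts := (hx.mem_of_ne fun e => hv (e ▸ hleaf x)).1
    obtain ⟨d, hd, hvd⟩ := hvv
    have hlt : d < c := by
      have h1 := hx.index_le hd hc hvd (hleaf x)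
      rcases h1.lt_or_eq with h2 | rfl
      · exact h2
      · exact absurd hvd hv
    -- Here `v` precedes the tent and is an ancestor of its apex, hence of all its leaves.
    have h1 := hx.le_apex hd hc hvd (hleaf x) hlt
    have : {x | T.Le v (leaf x)} = {x | ReflTransGen (T.tent c).Arc (T.apex c) (leaf x)} := by
      ext y
      exact ⟨fun _ => (T.tent c).reachable _ (hleaf y),
        fun _ => h1.trans (apex_le hc (hleaf y))⟩
    rw [this]
    exact h _ apex_mem

end TentTree

/-! ### From the conditions on bags to forced adjacencies. -/

theorem Obeys.adj_of_le {V : Type*} {G : SimpleGraph V} {xs ys : List V} (h : Obeys G xs ys)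
    {i i' : Fin xs.length} (hi : i ≤ i') {y : V} (hy : y ∈ ys) (hadj : G.Adj (xs.get i') y) :
    G.Adj (xs.get i) y := by
  obtain ⟨j, rfl⟩ := List.mem_iff_get.1 hy
  exact h i i' j j hi le_rfl hadj

theorem Obeys.adj_of_append {V : Type*} {G : SimpleGraph V} {xs l₁ l₂ l₃ : List V} {a b x : V}
    (h : Obeys G xs (l₁ ++ a :: (l₂ ++ b :: l₃))) (hx : x ∈ xs) (hadj : G.Adj x b) :
    G.Adj x a := by
  obtain ⟨i, rfl⟩ := List.mem_iff_get.1 hx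
  have := h i i ⟨l₁.length, by simp⟩ ⟨l₁.length + (l₂.length + 1), by simp⟩ le_rfl
    (by rw [Fin.mk_le_mk]; omega)
  simp only [List.get_eq_getElem] at this
  rw [List.getElem_append_right (by omega), List.getElem_append_right (by omega)] at this
  simp at this
  exact this hadj

theorem List.exists_isChain_of_reflTransGen {α : Type*} {r : α → α → Prop} {a b : α}
    (h : Relation.ReflTransGen r a b) :
    ∃ l : List α, List.IsChain r (l ++ [b]) ∧ (l ++ [b]).head? = some a := by
  induction h with
  | refl => exact ⟨[], by simp, by simp⟩
  | @tail b c _ hbc ih =>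
    obtain ⟨l, hl, hh⟩ := ih
    refine ⟨l ++ [b], ?_, ?_⟩
    · rw [List.append_assoc]
      exact List.isChain_split.2 ⟨hl, by simpa using hbc⟩
    · rw [List.head?_append, hh]; rfl

theorem List.exists_isChain_cons_of_reflTransGen {α : Type*} {r : α → α → Prop} {a b : α}
    (h : Relation.ReflTransGen r a b) (hne : a ≠ b) :
    ∃ l : List α, List.IsChain r (a :: (l ++ [b])) := by
  obtain ⟨l, hl, hh⟩ := List.exists_isChain_of_reflTransGen h
  cases l with
  | nil => simp at hh; exact absurd hh.symm hne
  | cons x l =>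
    simp at hh
    subst hh
    exact ⟨l, hl⟩

/-- The adjacencies that are forced in a hole of a blow-up, inside one of the two arborescences. -/
structure TentTree.Compat {U : Type*} (T : TentTree U) (K : SimpleGraph U) (H : Set U) : Prop where
  adj_le : ∀ {u v}, u ∈ T.verts → v ∈ T.verts → K.Adj u v → T.Le u v ∨ T.Le v u
  nonleaf : ∀ {u v}, u ≠ v → T.Le u v → u ∈ H → v ∈ H → (∀ c, ¬ T.IsLeaf c v) → K.Adj u v
  leaf_apex : ∀ {c t u}, T.IsLeaf c t → t ∈ H → u ∈ H → T.Le u (T.apex c) → K.Adj u t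
  leaf_desc : ∀ {c t u v}, T.IsLeaf c t → T.Le u v → T.Le v t → K.Adj v t → u ∈ H →
    u = v ∨ K.Adj u t

namespace TentTree

variable {U V : Type*}

/-- A vertex of the arborescence that is neither a leaf nor the apex of a tent has a one-element
bag, so the hole uses its representative from `D`. Bags of apexes are complete to all their
`D`-neighbours in the arborescence. Only leaves remain, and for these the tent condition says that
adjacency along the path from the root is automatic up to the apex of the tent and is inherited by
ancestors below it. -/
theorem compat_of_bags (T : TentTree U) {D : SimpleGraph U} {G : SimpleGraph V} (emb : D ↪g G)
    (bag : U → List V) (τ : V → U) (hτ : ∀ v t, v ∈ bag t ↔ τ v = t)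
    (hnonadj : ∀ t t', t ≠ t' → ¬ D.Adj t t' → AnticompleteTo G {x | x ∈ bag t} {x | x ∈ bag t'})
    (hD : ∀ u ∈ T.verts, ∀ v ∈ T.verts, D.Adj u v ↔ u ≠ v ∧ (T.Le u v ∨ T.Le v u))
    (hsingle : ∀ u ∈ T.verts, (∀ c, ¬ T.IsLeaf c u) → (∀ c ≤ T.last, u ≠ T.apex c) →
      bag u = [emb u])
    (hapex : ∀ t ∈ T.verts, ∀ c ≤ T.last, D.Adj (T.apex c) t →
      CompleteTo G {x | x ∈ bag t} {x | x ∈ bag (T.apex c)})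
    (htent : ∀ c ≤ T.last, ∀ t ∈ (T.tent c).leaves,
      TentLeafCondition G emb bag T.verts T.Arc (T.apex 0) (T.apex c) t)
    {n : ℕ} (c : SimpleGraph.cycleGraph n ↪g G) (hinj : Function.Injective (τ ∘ c)) :
    T.Compat ((SimpleGraph.cycleGraph n).map (τ ∘ c)) (Set.range (τ ∘ c)) := by
  set K := (SimpleGraph.cycleGraph n).map (τ ∘ c) with hK
  have hKG : ∀ i j, K.Adj (τ (c i)) (τ (c j)) ↔ G.Adj (c i) (c j) := by
    intro i j
    have := SimpleGraph.map_adj_apply (G := SimpleGraph.cycleGraph n) (f := ⟨τ ∘ c, hinj⟩)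
      (a := i) (b := j)
    rw [c.map_adj_iff]
    exact this
  have hbag : ∀ v, v ∈ bag (τ v) := fun v => (hτ v _).2 rfl
  have hsv : ∀ u ∈ T.verts, (∀ c, ¬ T.IsLeaf c u) → (∀ c ≤ T.last, u ≠ T.apex c) → ∀ x, τ x = u →
      x = emb u := by
    intro u hu h1 h2 x hx
    have h3 := (hτ x u).2 hx
    rw [hsingle u hu h1 h2] at h3
    simpa using h3
  have hmid : ∀ {u v : U} (h : T.Le u v), u ≠ v → ∀ c, ¬ T.IsLeaf c u :=
    fun h hne c hl => hne (hl.eq_of_le h).symm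
  have hleaf_apex : ∀ {d t u}, T.IsLeaf d t → t ∈ Set.range (τ ∘ c) → u ∈ Set.range (τ ∘ c) →
      T.Le u (T.apex d) → K.Adj u t := by
    rintro d _ _ hl ⟨i, rfl⟩ ⟨j, rfl⟩ hle
    rw [Function.comp_apply, Function.comp_apply] at *
    have hapt : T.Le (T.apex d) (τ (c i)) := apex_le hl.1 hl.mem
    have hut := hle.trans hapt
    have hne : τ (c j) ≠ τ (c i) := fun e => hmid hapt (hl.ne_apex hl.1).symm d (by
      have h2 := Le.antisymm hapt (e ▸ hle)
      rwa [h2])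
    have hv := hut.mem_of_ne hne
    rw [hKG]
    by_cases hap : ∃ e ≤ T.last, τ (c j) = T.apex e
    · obtain ⟨e, he, hje⟩ := hap
      refine (hapex (τ (c i)) hv.2 e he ?_ (c i) (hbag _) (c j) ?_).symm
      · rw [← hje, hD _ hv.1 _ hv.2]
        exact ⟨hne, Or.inl hut⟩
      · rw [← hje]; exact hbag _
    · push Not at hap
      -- Build the path from the root through this vertex and then the apex to the leaf, so that the
      -- vertex falls in the part `ys` of the tent condition, where adjacency is complete.
      obtain ⟨l₁, hl₁, hh₁⟩ := List.exists_isChain_of_reflTransGen (apex_zero_le hv.1)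
      obtain ⟨l₂, hl₂⟩ := List.exists_isChain_cons_of_reflTransGen hle (hap d hl.1)
      obtain ⟨l₃, hl₃⟩ := List.exists_isChain_cons_of_reflTransGen hapt (hl.ne_apex hl.1).symm
      have := htent d hl.1 _ hl.2 (l₁ ++ τ (c j) :: l₂) l₃ ?_ ?_
      · refine (this.1 (c i) (hbag _) (c j) ?_).symm
        exact ⟨τ (c j), by simp, hsv _ hv.1 (hmid hut hne) hap _ rfl⟩
      · rw [List.append_assoc]
        exact List.isChain_split.2 ⟨hl₁, List.isChain_split (l₁ := τ (c j) :: l₂).2 ⟨hl₂, hl₃⟩⟩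
      · rw [List.append_assoc, List.head?_append]
        rw [List.head?_append] at hh₁
        revert hh₁
        cases l₁ <;> simp
  refine ⟨?_, ?_, hleaf_apex, ?_⟩
  · intro u v hu hv hadj
    have hne := hadj.ne
    obtain ⟨-, i, j, hij, rfl, rfl⟩ := hadj
    have : D.Adj (τ (c i)) (τ (c j)) := by
      by_contra hn
      exact hnonadj _ _ hne hn _ (hbag _) _ (hbag _) (c.map_adj_iff.2 hij)
    exact ((hD _ hu _ hv).1 this).2
  · rintro _ _ hne hle ⟨i, rfl⟩ ⟨j, rfl⟩ hnl
    rw [Function.comp_apply, Function.comp_apply] at *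
    have hv := hle.mem_of_ne hne
    have hadj := (hD _ hv.1 _ hv.2).2 ⟨hne, Or.inl hle⟩
    rw [hKG]
    by_cases hap : ∃ e ≤ T.last, τ (c i) = T.apex e
    · obtain ⟨e, he, hje⟩ := hap
      exact (hapex (τ (c j)) hv.2 e he (hje ▸ hadj) _ (hbag _) _ (hje ▸ hbag _)).symm
    by_cases hap' : ∃ e ≤ T.last, τ (c j) = T.apex e
    · obtain ⟨e, he, hje⟩ := hap'
      exact hapex (τ (c i)) hv.1 e he (hje ▸ hadj.symm) _ (hbag _) _ (hje ▸ hbag _)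
    push Not at hap hap'
    rw [hsv _ hv.1 (hmid hle hne) hap _ rfl, hsv _ hv.2 hnl hap' _ rfl]
    exact emb.map_adj_iff.2 hadj
  · intro d t u v hl huv hvt hadj hu
    by_cases hne : u = v
    · exact Or.inl hne
    right
    have ht : t ∈ Set.range (τ ∘ c) := by
      obtain ⟨-, i, j, -, -, rfl⟩ := hadj
      exact ⟨j, rfl⟩
    have hvr : v ∈ Set.range (τ ∘ c) := by
      obtain ⟨-, i, j, -, rfl, -⟩ := hadj
      exact ⟨i, rfl⟩
    by_cases hua : T.Le u (T.apex d)
    · exact hleaf_apex hl ht hu hua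
    have hau : T.Le (T.apex d) u :=
      ((huv.trans hvt).total (apex_le hl.1 hl.mem)).resolve_left hua
    have hau' : T.apex d ≠ u := fun e => hua (e ▸ Relation.ReflTransGen.refl)
    have hvt' := hvt.mem_of_ne hadj.ne
    have huv' := huv.mem_of_ne hne
    have hap : ∀ e ≤ T.last, v ≠ T.apex e := by
      rintro e he rfl
      exact hua (huv.trans (apex_le_apex ((apex_le_iff he hl.1 hl.mem).1 hvt) hl.1))
    have hap' : ∀ e ≤ T.last, u ≠ T.apex e := by
      rintro e he rfl
      exact hua (apex_le_apex ((apex_le_iff he hl.1 hl.mem).1 (huv.trans hvt)) hl.1)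
    -- Now `u` and `v` both lie strictly between the apex and the leaf, with `u` earlier, so the
    -- ordering of `zs` passes the adjacency from `v` to `u`.
    obtain ⟨l₁, hl₁, hh₁⟩ := List.exists_isChain_of_reflTransGen
      (apex_zero_le (mem_verts hl.1 apex_mem))
    obtain ⟨l₂, hl₂⟩ := List.exists_isChain_cons_of_reflTransGen hau hau'
    obtain ⟨l₃, hl₃⟩ := List.exists_isChain_cons_of_reflTransGen huv hne
    obtain ⟨l₄, hl₄⟩ := List.exists_isChain_cons_of_reflTransGen hvt hadj.ne
    have := (htent d hl.1 _ hl.2 l₁ (l₂ ++ u :: (l₃ ++ v :: l₄)) ?_ ?_).2.2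
    · rw [List.map_append, List.map_cons, List.map_append, List.map_cons] at this
      obtain ⟨i, rfl⟩ := ht
      obtain ⟨j, rfl⟩ := hu
      obtain ⟨k, rfl⟩ := hvr
      simp only [Function.comp_apply] at *
      rw [hKG] at hadj ⊢
      have hj := hsv _ huv'.1 (hmid huv hne) hap' _ rfl
      have hk := hsv _ hvt'.1 (hmid hvt (fun e => hadj.ne (congrArg c (hinj e)))) hap _ rfl
      rw [hj]
      exact (this.adj_of_append (hbag _) (hk ▸ hadj.symm)).symm
    · rw [List.isChain_split]
      refine ⟨hl₁, ?_⟩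
      have h34 : List.IsChain T.Arc (u :: (l₃ ++ v :: (l₄ ++ [t]))) :=
        List.isChain_split (l₁ := u :: l₃).2 ⟨hl₃, hl₄⟩
      have := List.isChain_split (l₁ := T.apex d :: l₂).2 ⟨hl₂, h34⟩
      simpa using this
    · rw [List.head?_append] at hh₁ ⊢
      revert hh₁
      cases l₁ <;> simp

end TentTree

/-! ### How a cycle crosses an arborescence. -/

namespace TentTree

variable {U : Type*}

/-- The vertices `a p` (`p ∈ Q`) are those where the cycle `K` leaves the arborescence `T`. -/
structure Exits (T : TentTree U) (K : SimpleGraph U) (Q : Set ℕ) (a : ℕ → U) : Prop where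
  inj : ∀ p ∈ Q, ∀ q ∈ Q, a p = a q → p = q
  mem : ∀ p ∈ Q, a p ∈ T.verts
  out : ∀ p ∈ Q, ∃ w ∉ T.verts, K.Adj (a p) w
  out_unique : ∀ p ∈ Q, ∀ w ∉ T.verts, ∀ w' ∉ T.verts, K.Adj (a p) w → K.Adj (a p) w' → w = w'
  only : ∀ u ∈ T.verts, ∀ w ∉ T.verts, K.Adj u w → ∃ p ∈ Q, u = a p

/-- A vertex of the cycle `K` both of whose neighbours belong to the arborescence `T`. -/
def Mid (T : TentTree U) (K : SimpleGraph U) (v : U) : Prop :=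
  v ∈ T.verts ∧ ∀ w, K.Adj v w → w ∈ T.verts

/-- The cycle `K` goes through `T` from `a p` to `a q`, with at most one vertex in between. -/
def Mate (T : TentTree U) (K : SimpleGraph U) (a : ℕ → U) (p q : ℕ) : Prop :=
  p ≠ q ∧ (K.Adj (a p) (a q) ∨ ∃ v, T.Mid K v ∧ K.Adj v (a p) ∧ K.Adj v (a q))

variable {T : TentTree U} {K : SimpleGraph U} {H : Set U} {n : ℕ} {Q : Set ℕ} {a : ℕ → U}

theorem Mate.symm {p q : ℕ} (h : T.Mate K a p q) : T.Mate K a q p := by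
  refine ⟨h.1.symm, ?_⟩
  rcases h.2 with h | ⟨v, hv, h1, h2⟩
  · exact Or.inl h.symm
  · exact Or.inr ⟨v, hv, h2, h1⟩

/-- If a neighbour `y` were an ancestor of `v`, the other neighbour `z` would be comparable to `y`,
and the forced adjacencies would make `y` and `z` adjacent. This is impossible for the two
neighbours of a vertex of the cycle. -/
theorem Mid.lt (C : CycleOn K H n) (P : T.Compat K H) {v y : U} (hv : T.Mid K v)
    (hy : K.Adj v y) : T.Le v y := by
  obtain ⟨z, hz, hzy⟩ := C.exists_other hy
  have key : ∀ y z, K.Adj v y → K.Adj v z → y ≠ z → T.Le y v → T.Le z v ∨ T.Le v z → False := by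
    intro y z hy hz hne hyv hzv
    have hnadj := C.not_adj hy hz
    have hyH := C.mem_right hy
    have hzH := C.mem_right hz
    have hnl : ∀ {u w}, T.Le u w → u ≠ w → ∀ c, ¬ T.IsLeaf c u :=
      fun h hne c hl => hne (hl.eq_of_le h).symm
    rcases hzv with hzv | hvz
    · rcases hyv.total hzv with h | h
      · exact hnadj (P.nonleaf hne h hyH hzH (hnl hzv hz.ne.symm))
      · exact hnadj (P.nonleaf hne.symm h hzH hyH (hnl hyv hy.ne.symm)).symm
    · by_cases hl : ∃ c, T.IsLeaf c z
      · obtain ⟨c, hl⟩ := hl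
        rcases P.leaf_desc hl hyv hvz hz hyH with h | h
        · exact hy.ne h.symm
        · exact hnadj h
      · push Not at hl
        exact hnadj (P.nonleaf hne (hyv.trans hvz) hyH hzH hl)
  have hcy := P.adj_le hv.1 (hv.2 y hy) hy
  have hcz := P.adj_le hv.1 (hv.2 z hz) hz
  rcases hcy with h | h
  · exact h
  · exact (key y z hy hz hzy.symm h hcz.symm).elim

variable (C : CycleOn K H n) (P : T.Compat K H) (E : T.Exits K Q a)
include C P E

omit C P in
theorem Exits.not_mid {p : ℕ} (hp : p ∈ Q) : ¬ T.Mid K (a p) := by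
  intro h
  obtain ⟨w, hw, hadj⟩ := E.out p hp
  exact hw (h.2 w hadj)

/-- Two adjacent inner vertices would be ancestors of each other. So the cycle never has two
consecutive vertices of this kind. -/
theorem Mid.exists_exit {v y : U} (hv : T.Mid K v) (hy : K.Adj v y) : ∃ p ∈ Q, y = a p := by
  by_contra hcon
  have hmid : T.Mid K y := ⟨hv.2 y hy, fun w hw => by
    by_contra hwn
    exact hcon (E.only y (hv.2 y hy) w hwn hw)⟩
  exact hy.ne (Le.antisymm (hv.lt C P hy) (hmid.lt C P hy.symm))

omit P in
theorem Exits.exists_inner {p : ℕ} (hp : p ∈ Q) : ∃ w ∈ T.verts, K.Adj (a p) w := by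
  obtain ⟨w, hw, hadj⟩ := E.out p hp
  obtain ⟨y, hy, hyw⟩ := C.exists_other hadj
  by_cases hyT : y ∈ T.verts
  · exact ⟨y, hyT, hy⟩
  · exact absurd (E.out_unique p hp y hyT w hw hy hadj) hyw

omit P in
theorem Exits.inner_unique {p : ℕ} (hp : p ∈ Q) {y z : U} (hy : y ∈ T.verts) (hz : z ∈ T.verts)
    (hay : K.Adj (a p) y) (haz : K.Adj (a p) z) : y = z := by
  obtain ⟨w, hw, hadj⟩ := E.out p hp
  rcases C.eq_or_eq (fun e : y = w => hw (e ▸ hy)) hay hadj haz with h | h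
  · exact h.symm
  · exact absurd hz (h ▸ hw)

/-- Following the cycle from an exit into `T`, the next vertex is an exit, or is inner and followed
by an exit. Together with `Mate.unique` this makes mating a perfect matching of the exits. -/
theorem Exits.exists_mate {p : ℕ} (hp : p ∈ Q) : ∃ q ∈ Q, T.Mate K a p q := by
  obtain ⟨w, hw, hadj⟩ := E.exists_inner C hp
  by_cases hmid : T.Mid K w
  · obtain ⟨y, hy, hyp⟩ := C.exists_other hadj.symm
    obtain ⟨q, hq, rfl⟩ := hmid.exists_exit C P E hy
    exact ⟨q, hq, fun e => hyp (e ▸ rfl), Or.inr ⟨w, hmid, hadj.symm, hy⟩⟩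
  · obtain ⟨x, hx, hwx⟩ : ∃ x, K.Adj w x ∧ x ∉ T.verts := by
      by_contra hcon
      push Not at hcon
      exact hmid ⟨hw, hcon⟩
    obtain ⟨q, hq, rfl⟩ := E.only w hw x hwx hx
    exact ⟨q, hq, fun e => hadj.ne (e ▸ rfl), Or.inl hadj⟩

omit P in
theorem Mate.unique {p q q' : ℕ} (hp : p ∈ Q) (hq : q ∈ Q) (hq' : q' ∈ Q)
    (h : T.Mate K a p q) (h' : T.Mate K a p q') : q = q' := by
  rcases h.2 with h1 | ⟨v, hv, hvp, hvq⟩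
  · rcases h'.2 with h2 | ⟨w, hw, hwp, hwq⟩
    · exact E.inj q hq q' hq' (E.inner_unique C hp (E.mem q hq) (E.mem q' hq') h1 h2)
    · have := E.inner_unique C hp (E.mem q hq) hw.1 h1 hwp.symm
      exact absurd (this ▸ hw) (E.not_mid hq)
  · rcases h'.2 with h2 | ⟨w, hw, hwp, hwq⟩
    · have := E.inner_unique C hp (E.mem q' hq') hv.1 h2 hvp.symm
      exact absurd (this ▸ hv) (E.not_mid hq')
    · obtain rfl := E.inner_unique C hp hv.1 hw.1 hvp.symm hwp.symm
      rcases C.eq_or_eq (fun e => h.1 (E.inj p hp q hq e)) hvp hvq hwq with e | e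
      · exact absurd (E.inj q' hq' p hp e).symm h'.1
      · exact (E.inj q' hq' q hq e).symm

omit P in
theorem Exits.mem_cycle {p : ℕ} (hp : p ∈ Q) : a p ∈ H := by
  obtain ⟨w, -, hadj⟩ := E.out p hp
  exact C.mem hadj

omit P in
/-- The part of the cycle inside `T` between `a p` and `a q`. -/
theorem Mate.inner_cases {p q : ℕ} (hp : p ∈ Q) (hq : q ∈ Q) (h : T.Mate K a p q) {w : U}
    (hw : w ∈ T.verts) (hadj : K.Adj (a p) w) :
    w = a q ∨ (T.Mid K w ∧ K.Adj w (a p) ∧ K.Adj w (a q)) := by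
  rcases h.2 with h1 | ⟨v, hv, hvp, hvq⟩
  · exact Or.inl (E.inner_unique C hp hw (E.mem q hq) hadj h1)
  · obtain rfl := E.inner_unique C hp hw hv.1 hadj hvp.symm
    exact Or.inr ⟨hv, hvp, hvq⟩

omit C P E in
theorem adj_of_apexes (P : T.Compat K H) {c c' : ℕ} (hc : c ≤ T.last) (hc' : c' ≤ T.last)
    (hne : c ≠ c') (h : T.apex c ∈ H) (h' : T.apex c' ∈ H) : K.Adj (T.apex c) (T.apex c') := by
  have hne' : T.apex c ≠ T.apex c' := fun e => hne (eq_of_mem hc hc' apex_mem (e ▸ apex_mem))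
  rcases le_total c c' with hle | hle
  · exact P.nonleaf hne' (apex_le_apex hle hc') h h' (fun d hd => hd.ne_apex hc' rfl)
  · exact (P.nonleaf hne'.symm (apex_le_apex hle hc) h' h (fun d hd => hd.ne_apex hc rfl)).symm

omit C P E in
theorem Compat.not_adj_leaves (P : T.Compat K H) {c c' : ℕ} {t t' : U} (h : T.IsLeaf c t)
    (h' : T.IsLeaf c' t') : ¬ K.Adj t t' := by
  intro hadj
  rcases P.adj_le (mem_verts h.1 h.mem) (mem_verts h'.1 h'.mem) hadj with hle | hle
  · exact hadj.ne (h.eq_of_le hle).symm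
  · exact hadj.ne (h'.eq_of_le hle)

omit C P E in
theorem Compat.adj_apex_leaf_iff (P : T.Compat K H) {c c' : ℕ} {t : U} (hc : c ≤ T.last)
    (h : T.IsLeaf c' t) (ht : t ∈ H) (hcH : T.apex c ∈ H) :
    K.Adj (T.apex c) t ↔ c ≤ c' := by
  constructor
  · intro hadj
    rcases P.adj_le (mem_verts hc apex_mem) (mem_verts h.1 h.mem) hadj with hle | hle
    · exact (apex_le_iff hc h.1 h.mem).1 hle
    · exact absurd (h.eq_of_le hle) hadj.ne
  · intro hle
    exact P.leaf_apex h ht hcH (apex_le_apex hle h.1)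

/-- Two inner vertices with a common descendant are comparable. They are not leaves, so if distinct
they would be adjacent, whereas the neighbours of an inner vertex are exits. Thus different pairs of
leaves have disjoint sets of descendants, as the argument on subtrees requires. -/
theorem Mid.eq_of_le {v v' x y : U} (hv : T.Mid K v) (hv' : T.Mid K v') (hy : K.Adj v y)
    (hy' : ∃ y', K.Adj v' y') (hx : T.Le v x) (hx' : T.Le v' x) : v = v' := by
  have key : ∀ {v v' y y' : U}, T.Mid K v → T.Mid K v' → K.Adj v y → K.Adj v' y' → T.Le v v' →
      v = v' := by
    intro v v' y y' hv hv' hy hy' hle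
    by_contra hne
    have hnl : ∀ c, ¬ T.IsLeaf c v' := fun c hl => hy'.ne (hl.eq_of_le (hv'.lt C P hy')).symm
    have hadj := P.nonleaf hne hle (C.mem hy) (C.mem hy') hnl
    obtain ⟨p, hp, rfl⟩ := hv.exists_exit C P E hadj
    exact E.not_mid hp hv'
  obtain ⟨y', hy'⟩ := hy'
  rcases hx.total hx' with h | h
  · exact key hv hv' hy hy' h
  · exact (key hv' hv hy' hy h).symm

omit E in
theorem Mate.exists_mid {p q cp cq : ℕ} (h : T.Mate K a p q) (hp : T.IsLeaf cp (a p))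
    (hq : T.IsLeaf cq (a q)) :
    ∃ v, T.Mid K v ∧ K.Adj v (a p) ∧ K.Adj v (a q) ∧ T.Le v (a p) ∧ T.Le v (a q) := by
  rcases h.2 with h1 | ⟨v, hv, hvp, hvq⟩
  · exact absurd h1 (P.not_adj_leaves hp hq)
  · exact ⟨v, hv, hvp, hvq, hv.lt C P hvp, hv.lt C P hvq⟩

/-- The vertex between `a p` and `a q` has a descendant in a later tent, hence is an ancestor of
every later apex. A leaf `a r` in a tent after that of `a p` would therefore be a third neighbour of
it. -/
theorem Mate.index_le {p q r cp cq cr : ℕ} (h : T.Mate K a p q) (hpQ : p ∈ Q) (hqQ : q ∈ Q)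
    (hrQ : r ∈ Q) (hp : T.IsLeaf cp (a p)) (hq : T.IsLeaf cq (a q)) (hr : T.IsLeaf cr (a r))
    (hlt : cp < cq) (hrp : r ≠ p) (hrq : r ≠ q) : cr ≤ cp := by
  by_contra! hcr
  obtain ⟨v, hv, hvp, hvq, hlp, hlq⟩ := h.exists_mid C P hp hq
  obtain ⟨c, hc, hvc⟩ := hv.1
  have hcp := hlp.index_le hc hp.1 hvc hp.mem
  have hle := hlq.le_apex_of_lt hc hq.1 hr.1 hvc hq.mem (by omega) (by omega)
  have hadj := P.leaf_apex hr (E.mem_cycle C hrQ) (C.mem hvp) hle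
  rcases C.eq_or_eq (fun e => h.1 (E.inj p hpQ q hqQ e)) hvp hvq hadj with e | e
  · exact hrp (E.inj r hrQ p hpQ e)
  · exact hrq (E.inj r hrQ q hqQ e)

end TentTree

/-! ### Paths between two arborescences, and the length of a cycle made of two of them. -/

/-- Two arborescences `T` and `S` joined up by the paths `bar p 0, …, bar p (len p)` (`p ∈ I`) from
`T` to `S`; the edges of `K` belong to `T`, to `S` or to one of the paths. -/
structure BarSystem {U : Type*} (T S : TentTree U) (K : SimpleGraph U) (I : Set ℕ)
    (bar : ℕ → ℕ → U) (len : ℕ → ℕ) : Prop where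
  len_pos : ∀ p ∈ I, 1 ≤ len p
  inj : ∀ p ∈ I, ∀ q ∈ I, ∀ s ≤ len p, ∀ s' ≤ len q, bar p s = bar q s' → p = q ∧ s = s'
  first_mem : ∀ p ∈ I, bar p 0 ∈ T.verts
  last_mem : ∀ p ∈ I, bar p (len p) ∈ S.verts
  eq_first : ∀ p ∈ I, ∀ s ≤ len p, bar p s ∈ T.verts → s = 0
  eq_last : ∀ p ∈ I, ∀ s ≤ len p, bar p s ∈ S.verts → s = len p
  disjoint : Disjoint T.verts S.verts
  cover : ∀ u, u ∈ T.verts ∨ u ∈ S.verts ∨ ∃ p ∈ I, ∃ s ≤ len p, u = bar p s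
  adj : ∀ u v, K.Adj u v → (u ∈ T.verts ∧ v ∈ T.verts) ∨ (u ∈ S.verts ∧ v ∈ S.verts) ∨
    (∃ p ∈ I, ∃ s < len p, u = bar p s ∧ v = bar p (s + 1)) ∨
    (∃ p ∈ I, ∃ s < len p, v = bar p s ∧ u = bar p (s + 1))

namespace BarSystem

variable {U : Type*} {T S : TentTree U} {K : SimpleGraph U} {H : Set U} {n : ℕ} {I : Set ℕ}
  {bar : ℕ → ℕ → U} {len : ℕ → ℕ}

/-- The indices of the paths that are contained in `K`. -/
def full (K : SimpleGraph U) (I : Set ℕ) (bar : ℕ → ℕ → U) (len : ℕ → ℕ) : Set ℕ :=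
  {p | p ∈ I ∧ ∀ s < len p, K.Adj (bar p s) (bar p (s + 1))}

/-- Reversing the paths exchanges `T` and `S`, so that statements about the first ends carry over to
the last ends. -/
theorem symm (B : BarSystem T S K I bar len) :
    BarSystem S T K I (fun p s => bar p (len p - s)) len where
  len_pos := B.len_pos
  inj p hp q hq s hs s' hs' h := by
    obtain ⟨rfl, h'⟩ := B.inj p hp q hq _ (Nat.sub_le _ _) _ (Nat.sub_le _ _) h
    exact ⟨rfl, by omega⟩
  first_mem := B.last_mem
  last_mem p hp := by simpa using B.first_mem p hp
  eq_first p hp s hs h := by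
    have := B.eq_last p hp _ (Nat.sub_le _ _) h
    omega
  eq_last p hp s hs h := by
    have := B.eq_first p hp _ (Nat.sub_le _ _) h
    omega
  disjoint := B.disjoint.symm
  cover u := by
    rcases B.cover u with h | h | ⟨p, hp, s, hs, rfl⟩
    · exact Or.inr (Or.inl h)
    · exact Or.inl h
    · exact Or.inr (Or.inr ⟨p, hp, len p - s, Nat.sub_le _ _, by congr 1; omega⟩)
  adj u v h := by
    rcases B.adj u v h with h | h | ⟨p, hp, s, hs, rfl, rfl⟩ | ⟨p, hp, s, hs, rfl, rfl⟩
    · exact Or.inr (Or.inl h)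
    · exact Or.inl h
    · refine Or.inr (Or.inr (Or.inr ⟨p, hp, len p - (s + 1), by omega, ?_, ?_⟩)) <;>
        congr 1 <;> omega
    · refine Or.inr (Or.inr (Or.inl ⟨p, hp, len p - (s + 1), by omega, ?_, ?_⟩)) <;>
        congr 1 <;> omega

theorem full_symm : full K I (fun p s => bar p (len p - s)) len = full K I bar len := by
  ext p
  constructor
  · rintro ⟨hp, h⟩
    refine ⟨hp, fun s hs => ?_⟩
    have := h (len p - (s + 1)) (by omega)
    simp only at this
    rw [show len p - (len p - (s + 1)) = s + 1 by omega,
      show len p - (len p - (s + 1) + 1) = s by omega] at this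
    exact this.symm
  · rintro ⟨hp, h⟩
    refine ⟨hp, fun s hs => ?_⟩
    have := h (len p - (s + 1)) (by omega)
    rw [show len p - (s + 1) + 1 = len p - s by omega] at this
    exact this.symm

variable (C : CycleOn K H n) (B : BarSystem T S K I bar len)
include B

theorem adj_first_iff {p : ℕ} (hp : p ∈ I) {w : U} (hw : w ∉ T.verts)
    (h : K.Adj (bar p 0) w) : w = bar p 1 := by
  have hlen := B.len_pos p hp
  rcases B.adj _ _ h with h | h | ⟨q, hq, s, hs, e, rfl⟩ | ⟨q, hq, s, hs, rfl, e⟩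
  · exact absurd h.2 hw
  · have := B.eq_last p hp 0 (Nat.zero_le _) h.1
    omega
  · obtain ⟨rfl, rfl⟩ := B.inj p hp q hq _ (Nat.zero_le _) _ hs.le e
    rfl
  · obtain ⟨rfl, h⟩ := B.inj p hp q hq _ (Nat.zero_le _) _ hs e
    omega

include C

/-- An inner vertex of a path lies in neither arborescence, so both its neighbours on the cycle are
its neighbours on the path. Hence the cycle contains all edges of a path or none. -/
theorem adj_succ {p s : ℕ} (hp : p ∈ I) (hs : s + 1 < len p)
    (h : K.Adj (bar p s) (bar p (s + 1))) : K.Adj (bar p (s + 1)) (bar p (s + 2)) := by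
  obtain ⟨y, hy, hne⟩ := C.exists_other h.symm
  rcases B.adj _ _ hy with h | h | ⟨q, hq, t, ht, h, rfl⟩ | ⟨q, hq, t, ht, rfl, h⟩
  · have := B.eq_first p hp _ hs.le h.1
    omega
  · have := B.eq_last p hp _ hs.le h.1
    omega
  · obtain ⟨rfl, rfl⟩ := B.inj p hp q hq _ hs.le _ ht.le h
    exact hy
  · obtain ⟨rfl, h⟩ := B.inj p hp q hq _ hs.le _ ht h
    obtain rfl : s = t := by omega
    exact absurd rfl hne

theorem adj_of_le {p s t : ℕ} (hp : p ∈ I) (hst : s ≤ t) (ht : t < len p)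
    (h : K.Adj (bar p s) (bar p (s + 1))) : K.Adj (bar p t) (bar p (t + 1)) := by
  induction t, hst using Nat.le_induction with
  | base => exact h
  | succ t _ ih => exact B.adj_succ C hp ht (ih (by omega))

theorem mem_full {p s : ℕ} (hp : p ∈ I) (hs : s < len p)
    (h : K.Adj (bar p s) (bar p (s + 1))) : p ∈ full K I bar len := by
  refine ⟨hp, fun t ht => ?_⟩
  rcases le_total s t with hst | hst
  · exact B.adj_of_le C hp hst ht h
  · have h0 : K.Adj (bar p (len p - (len p - (s + 1)))) (bar p (len p - (len p - (s + 1) + 1))) := by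
      rw [show len p - (len p - (s + 1)) = s + 1 by omega,
        show len p - (len p - (s + 1) + 1) = s by omega]
      exact h.symm
    have := B.symm.adj_of_le C (t := len p - (t + 1)) hp (by omega) (by omega) h0
    rw [show len p - (len p - (t + 1)) = t + 1 by omega,
      show len p - (len p - (t + 1) + 1) = t by omega] at this
    exact this.symm

theorem exits : T.Exits K (full K I bar len) (fun p => bar p 0) where
  inj p hp q hq h := (B.inj p hp.1 q hq.1 0 (Nat.zero_le _) 0 (Nat.zero_le _) h).1
  mem p hp := B.first_mem p hp.1
  out p hp := by
    refine ⟨bar p 1, fun h => ?_, hp.2 0 (B.len_pos p hp.1)⟩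
    have := B.eq_first p hp.1 1 (B.len_pos p hp.1) h
    omega
  out_unique p hp w hw w' hw' h h' :=
    (B.adj_first_iff hp.1 hw h).trans (B.adj_first_iff hp.1 hw' h').symm
  only u hu w hw h := by
    rcases B.adj _ _ h with h' | h' | ⟨q, hq, t, ht, rfl, rfl⟩ | ⟨q, hq, t, ht, rfl, rfl⟩
    · exact absurd h'.2 hw
    · exact absurd h'.1 (Set.disjoint_left.1 B.disjoint hu)
    · obtain rfl := B.eq_first q hq t ht.le hu
      exact ⟨q, B.mem_full C hq ht h, rfl⟩
    · have := B.eq_first q hq _ ht hu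
      omega

theorem exits_last : S.Exits K (full K I bar len) (fun p => bar p (len p)) := by
  have := B.symm.exits C
  rwa [full_symm] at this

theorem exists_full_of_mem (P : T.Compat K H) {u : U} (hu : u ∈ H) (huT : u ∈ T.verts) :
    (full K I bar len).Nonempty := by
  by_cases hmid : T.Mid K u
  · obtain ⟨y, z, -, hy, -⟩ := C.exists_two hu
    obtain ⟨p, hp, -⟩ := hmid.exists_exit C P (B.exits C) hy
    exact ⟨p, hp⟩
  · have : ∃ w, K.Adj u w ∧ w ∉ T.verts := by
      by_contra! hcon
      exact hmid ⟨huT, hcon⟩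
    obtain ⟨w, hw, hwT⟩ := this
    obtain ⟨p, hp, -⟩ := (B.exits C).only u huT w hwT hw
    exact ⟨p, hp⟩

/-- A cycle cannot stay inside one arborescence, since the neighbours of an inner vertex are exits.
-/
theorem full_nonempty (P : T.Compat K H) (P' : S.Compat K H) :
    (full K I bar len).Nonempty := by
  obtain ⟨u, hu⟩ := C.nonempty
  obtain ⟨y, z, -, hy, -⟩ := C.exists_two hu
  rcases B.adj _ _ hy with h | h | ⟨q, hq, t, ht, rfl, rfl⟩ | ⟨q, hq, t, ht, rfl, rfl⟩
  · exact B.exists_full_of_mem C P hu h.1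
  · have := B.symm.exists_full_of_mem C P' hu h.1
    rwa [full_symm] at this
  · exact ⟨q, B.mem_full C hq ht hy⟩
  · exact ⟨q, B.mem_full C hq ht hy.symm⟩

omit B in
theorem ncard_between {T : TentTree U} {Q : Set ℕ} {a : ℕ → U} (E : T.Exits K Q a) {p q : ℕ}
    (hp : p ∈ Q) (h : T.Mate K a p q) [Decidable (K.Adj (a p) (a q))] :
    {v | T.Mid K v ∧ K.Adj v (a p) ∧ K.Adj v (a q)}.ncard =
      if K.Adj (a p) (a q) then 0 else 1 := by
  split_ifs with hadj
  · rw [Set.ncard_eq_zero (C.finite.subset fun v hv => C.mem hv.2.1)]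
    refine Set.eq_empty_of_forall_notMem fun v hv => C.not_adj hv.2.1 hv.2.2 hadj
  · obtain ⟨v, hv⟩ := h.2.resolve_left hadj
    rw [Set.ncard_eq_one]
    refine ⟨v, Set.eq_singleton_iff_unique_mem.2 ⟨hv, fun w hw => ?_⟩⟩
    exact E.inner_unique C hp hw.1.1 hv.1.1 hw.2.1.symm hv.2.1.symm

theorem adj_bar_cases {p q : ℕ} (hp : p ∈ full K I bar len) (hq : q ∈ full K I bar len)
    (h : T.Mate K (fun p => bar p 0) p q) (h' : S.Mate K (fun p => bar p (len p)) p q) {s : ℕ}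
    (hs : s ≤ len p) {v : U} (hv : K.Adj (bar p s) v) :
    v ∈ bar p '' Set.Iic (len p) ∨ v ∈ bar q '' Set.Iic (len q) ∨
      (T.Mid K v ∧ K.Adj v (bar p 0) ∧ K.Adj v (bar q 0)) ∨
      (S.Mid K v ∧ K.Adj v (bar p (len p)) ∧ K.Adj v (bar q (len q))) := by
  rcases B.adj _ _ hv with hh | hh | ⟨r, hr, t, ht, e, rfl⟩ | ⟨r, hr, t, ht, rfl, e⟩
  · obtain rfl := B.eq_first p hp.1 s hs hh.1
    rcases h.inner_cases C (B.exits C) hp hq hh.2 hv with rfl | h1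
    · exact Or.inr (Or.inl ⟨0, Nat.zero_le _, rfl⟩)
    · exact Or.inr (Or.inr (Or.inl h1))
  · obtain rfl := B.eq_last p hp.1 s hs hh.1
    rcases h'.inner_cases C (B.exits_last C) hp hq hh.2 hv with rfl | h1
    · exact Or.inr (Or.inl ⟨len q, Set.self_mem_Iic, rfl⟩)
    · exact Or.inr (Or.inr (Or.inr h1))
  · obtain ⟨rfl, rfl⟩ := B.inj p hp.1 r hr _ hs _ ht.le e
    exact Or.inl ⟨s + 1, ht, rfl⟩
  · obtain ⟨rfl, rfl⟩ := B.inj p hp.1 r hr _ hs _ ht e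
    exact Or.inl ⟨t, ht.le, rfl⟩

/-- The two paths and the inner vertices joining their ends are closed under adjacency in the cycle;
by connectedness they are all of it. -/
theorem eq_union_of_mates {p q : ℕ} (hp : p ∈ full K I bar len) (hq : q ∈ full K I bar len)
    (h : T.Mate K (fun p => bar p 0) p q) (h' : S.Mate K (fun p => bar p (len p)) p q) :
    (bar p '' Set.Iic (len p) ∪ bar q '' Set.Iic (len q)) ∪
      ({v | T.Mid K v ∧ K.Adj v (bar p 0) ∧ K.Adj v (bar q 0)} ∪
      {v | S.Mid K v ∧ K.Adj v (bar p (len p)) ∧ K.Adj v (bar q (len q))}) = H := by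
  have hbar : ∀ r ∈ full K I bar len, ∀ s ≤ len r, bar r s ∈ H := by
    intro r hr s hs
    rcases Nat.lt_or_ge s (len r) with h1 | h1
    · exact C.mem (hr.2 s h1)
    · obtain ⟨t, rfl⟩ : ∃ t, s = t + 1 := ⟨s - 1, by have := B.len_pos r hr.1; omega⟩
      exact C.mem_right (hr.2 t (by omega))
  have hpq : bar p 0 ≠ bar q 0 := fun e => h.1 ((B.exits C).inj p hp q hq e)
  have hpq' : bar p (len p) ≠ bar q (len q) := fun e => h.1 ((B.exits_last C).inj p hp q hq e)
  apply C.conn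
  · rintro v ((⟨s, hs, rfl⟩ | ⟨s, hs, rfl⟩) | hv | hv)
    · exact hbar p hp s hs
    · exact hbar q hq s hs
    · exact C.mem hv.2.1
    · exact C.mem hv.2.1
  · exact ⟨bar p 0, Or.inl (Or.inl ⟨0, Nat.zero_le _, rfl⟩)⟩
  · rintro u ((⟨s, hs, rfl⟩ | ⟨s, hs, rfl⟩) | hu | hu) v huv
    · rcases B.adj_bar_cases C hp hq h h' hs huv with h1 | h1 | h1 | h1
      · exact Or.inl (Or.inl h1)
      · exact Or.inl (Or.inr h1)
      · exact Or.inr (Or.inl h1)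
      · exact Or.inr (Or.inr h1)
    · rcases B.adj_bar_cases C hq hp h.symm h'.symm hs huv with h1 | h1 | h1 | h1
      · exact Or.inl (Or.inr h1)
      · exact Or.inl (Or.inl h1)
      · exact Or.inr (Or.inl ⟨h1.1, h1.2.symm⟩)
      · exact Or.inr (Or.inr ⟨h1.1, h1.2.symm⟩)
    · rcases C.eq_or_eq hpq hu.2.1 hu.2.2 huv with rfl | rfl
      · exact Or.inl (Or.inl ⟨0, Nat.zero_le _, rfl⟩)
      · exact Or.inl (Or.inr ⟨0, Nat.zero_le _, rfl⟩)
    · rcases C.eq_or_eq hpq' hu.2.1 hu.2.2 huv with rfl | rfl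
      · exact Or.inl (Or.inl ⟨_, Set.self_mem_Iic, rfl⟩)
      · exact Or.inl (Or.inr ⟨_, Set.self_mem_Iic, rfl⟩)

omit C in
theorem ncard_bar {p : ℕ} (hp : p ∈ I) : (bar p '' Set.Iic (len p)).ncard = len p + 1 := by
  have hinj : Set.InjOn (bar p) (Set.Iic (len p)) :=
    fun s hs t ht e => (B.inj p hp p hp s hs t ht e).2
  rw [hinj.ncard_image]
  rw [← Finset.coe_Iic, Set.ncard_coe_finset, Nat.card_Iic]

open Classical in
/-- The length of a cycle that consists of two of the paths and what joins them up in `T`, `S`. -/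
theorem length_eq_of_mates {p q : ℕ} (hp : p ∈ full K I bar len) (hq : q ∈ full K I bar len)
    (h : T.Mate K (fun p => bar p 0) p q) (h' : S.Mate K (fun p => bar p (len p)) p q) :
    n = ((len p + 1) + (len q + 1)) + ((if K.Adj (bar p 0) (bar q 0) then 0 else 1) +
      (if K.Adj (bar p (len p)) (bar q (len q)) then 0 else 1)) := by
  have hU := B.eq_union_of_mates C hp hq h h'
  have hfin := C.finite
  rw [← hU] at hfin
  have hf1 := hfin.subset Set.subset_union_left
  have hf2 := hfin.subset Set.subset_union_right
  have hM : ∀ v, T.Mid K v → v ∉ bar p '' Set.Iic (len p) ∪ bar q '' Set.Iic (len q) := by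
    rintro v hv (⟨s, hs, rfl⟩ | ⟨s, hs, rfl⟩)
    · obtain rfl := B.eq_first p hp.1 s hs hv.1
      exact (B.exits C).not_mid hp hv
    · obtain rfl := B.eq_first q hq.1 s hs hv.1
      exact (B.exits C).not_mid hq hv
  have hM' : ∀ v, S.Mid K v → v ∉ bar p '' Set.Iic (len p) ∪ bar q '' Set.Iic (len q) := by
    rintro v hv (⟨s, hs, rfl⟩ | ⟨s, hs, rfl⟩)
    · obtain rfl := B.eq_last p hp.1 s hs hv.1
      exact (B.exits_last C).not_mid hp hv
    · obtain rfl := B.eq_last q hq.1 s hs hv.1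
      exact (B.exits_last C).not_mid hq hv
  rw [← C.card, ← hU, Set.ncard_union_eq _ hf1 hf2, Set.ncard_union_eq _
    (hf1.subset Set.subset_union_left) (hf1.subset Set.subset_union_right),
    Set.ncard_union_eq _ (hf2.subset Set.subset_union_left) (hf2.subset Set.subset_union_right),
    B.ncard_bar hp.1, B.ncard_bar hq.1, ← ncard_between C (B.exits C) hp h,
    ← ncard_between C (B.exits_last C) hp h']
  · rw [Set.disjoint_left]
    rintro v hv hv'
    exact Set.disjoint_left.1 B.disjoint hv.1.1 hv'.1.1
  · rw [Set.disjoint_left]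
    rintro _ ⟨s, hs, rfl⟩ ⟨t, ht, e⟩
    exact h.1 (B.inj q hq.1 p hp.1 t ht s hs e).1.symm
  · rw [Set.disjoint_right]
    rintro v (hv | hv)
    · exact hM v hv.1
    · exact hM' v hv.1

end BarSystem

/-! ### Common pairs of the upper and the lower pairing. -/

/-- Two fixed-point-free involutions `f`, `g` of a nonempty set agree somewhere if the set is covered
by two sets `A`, `B` such that `f` exchanges any two members of `A` and `g` any two members of `B`. -/
theorem exists_eq_of_exchange {Q A B : Set ℕ} {f g : ℕ → ℕ} (hQ : Q.Nonempty)
    (hf : ∀ p ∈ Q, f p ∈ Q ∧ p ≠ f p ∧ f (f p) = p) (hg : ∀ p ∈ Q, g p ∈ Q ∧ p ≠ g p ∧ g (g p) = p)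
    (hA : ∀ p ∈ Q, ∀ q ∈ Q, p ≠ q → p ∈ A → q ∈ A → f p = q)
    (hB : ∀ p ∈ Q, ∀ q ∈ Q, p ≠ q → p ∈ B → q ∈ B → g p = q) (h : ∀ p ∈ Q, p ∈ A ∨ p ∈ B) :
    ∃ p ∈ Q, f p = g p := by
  by_contra! hfg
  -- If `i`, `j` are distinct members of `A`, they are exchanged by `f`. Then `g i`, `g j` cannot
  -- lie in `A`, so they lie in `B` and are exchanged by `g`; this gives `g j = i = f j`.
  have key : ∀ {A B : Set ℕ} {f g : ℕ → ℕ},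
      (∀ p ∈ Q, f p ∈ Q ∧ p ≠ f p ∧ f (f p) = p) → (∀ p ∈ Q, g p ∈ Q ∧ p ≠ g p ∧ g (g p) = p) →
      (∀ p ∈ Q, ∀ q ∈ Q, p ≠ q → p ∈ A → q ∈ A → f p = q) →
      (∀ p ∈ Q, ∀ q ∈ Q, p ≠ q → p ∈ B → q ∈ B → g p = q) → (∀ p ∈ Q, p ∈ A ∨ p ∈ B) →
      (∀ p ∈ Q, f p ≠ g p) → ∀ i ∈ Q, ∀ j ∈ Q, i ≠ j → i ∈ A → j ∈ A → False := by
    intro A B f g hf hg hA hB h hfg i hi j hj hij hiA hjA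
    have h1 := hA i hi j hj hij hiA hjA
    have h2 := hA j hj i hi hij.symm hjA hiA
    obtain ⟨hp, hip, hgp⟩ := hg i hi
    obtain ⟨hp', hjp, hgp'⟩ := hg j hj
    have h3 := hfg i hi
    have h4 := hfg j hj
    have hpB : g i ∈ B := (h _ hp).resolve_left fun hh => h3 (hA i hi _ hp hip hiA hh)
    have hpB' : g j ∈ B := (h _ hp').resolve_left fun hh => h4 (hA j hj _ hp' hjp hjA hh)
    have hne : g i ≠ g j := fun e => hij (by rw [← hgp, e, hgp'])
    have h5 := hB _ hp _ hp' hne hpB hpB'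
    exact h4 (by rw [h2, ← h5, hgp])
  have keyA := key hf hg hA hB h hfg
  have keyB := key hg hf hB hA (fun p hp => (h p hp).symm) (fun p hp => (hfg p hp).symm)
  obtain ⟨p, hp⟩ := hQ
  have h1 := hf p hp
  have h2 := hg p hp
  have h3 := hfg p hp
  -- Each of `A`, `B` contains at most one element of `Q`, but `p`, `f p`, `g p` are three distinct
  -- ones.
  rcases h p hp with hp1 | hp1 <;> rcases h _ h1.1 with hp2 | hp2 <;>
    rcases h _ h2.1 with hp3 | hp3
  · exact keyA _ hp _ h1.1 h1.2.1 hp1 hp2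
  · exact keyA _ hp _ h1.1 h1.2.1 hp1 hp2
  · exact keyA _ hp _ h2.1 h2.2.1 hp1 hp3
  · exact keyB _ h1.1 _ h2.1 h3 hp2 hp3
  · exact keyA _ h1.1 _ h2.1 h3 hp2 hp3
  · exact keyB _ hp _ h2.1 h2.2.1 hp1 hp3
  · exact keyB _ hp _ h1.1 h1.2.1 hp1 hp2
  · exact keyB _ hp _ h1.1 h1.2.1 hp1 hp2

namespace TentTree

variable {U : Type*} {T S : TentTree U} {K : SimpleGraph U} {H : Set U} {n : ℕ} {Q : Set ℕ}
  {a b : ℕ → U}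

theorem Exits.mate_of_apexes (C : CycleOn K H n) (P : T.Compat K H) (E : T.Exits K Q a) {p q : ℕ}
    (hp : p ∈ Q) (hq : q ∈ Q) (hpq : p ≠ q) (hap : ∃ c ≤ T.last, a p = T.apex c)
    (haq : ∃ c ≤ T.last, a q = T.apex c) : T.Mate K a p q := by
  obtain ⟨c, hc, hpc⟩ := hap
  obtain ⟨d, hd, hqd⟩ := haq
  have hpH := E.mem_cycle C hp
  have hqH := E.mem_cycle C hq
  refine ⟨hpq, Or.inl ?_⟩
  have hcd : c ≠ d := by
    rintro rfl
    exact hpq (E.inj p hp q hq (hpc.trans hqd.symm))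
  rw [hpc, hqd]
  exact adj_of_apexes P hc hd hcd (hpc ▸ hpH) (hqd ▸ hqH)

/-- If every exit index is an apex of `T` or an apex of `S`, then two of them are joined up in both
`T` and `S`. -/
theorem exists_common_mates_of_apex (C : CycleOn K H n) (P : T.Compat K H) (P' : S.Compat K H)
    (E : T.Exits K Q a) (E' : S.Exits K Q b) (hQ : Q.Nonempty)
    (h : ∀ p ∈ Q, (∃ c ≤ T.last, a p = T.apex c) ∨ ∃ c ≤ S.last, b p = S.apex c) :
    ∃ p ∈ Q, ∃ q ∈ Q, T.Mate K a p q ∧ S.Mate K b p q := by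
  choose! f hfQ hf using fun p hp => E.exists_mate C P (p := p) hp
  choose! g hgQ hg using fun p hp => E'.exists_mate C P' (p := p) hp
  obtain ⟨p, hp, hfg⟩ := exists_eq_of_exchange (A := {p | ∃ c ≤ T.last, a p = T.apex c})
    (B := {p | ∃ c ≤ S.last, b p = S.apex c}) hQ
    (fun p hp => ⟨hfQ p hp, (hf p hp).1, (hf _ (hfQ p hp)).unique C E (hfQ p hp)
      (hfQ _ (hfQ p hp)) hp (hf p hp).symm⟩)
    (fun p hp => ⟨hgQ p hp, (hg p hp).1, (hg _ (hgQ p hp)).unique C E' (hgQ p hp)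
      (hgQ _ (hgQ p hp)) hp (hg p hp).symm⟩)
    (fun p hp q hq hpq h1 h2 =>
      (hf p hp).unique C E hp (hfQ p hp) hq (E.mate_of_apexes C P hp hq hpq h1 h2))
    (fun p hp q hq hpq h1 h2 =>
      (hg p hp).unique C E' hp (hgQ p hp) hq (E'.mate_of_apexes C P' hp hq hpq h1 h2)) h
  exact ⟨p, hp, f p, hfQ p hp, hf p hp, hfg ▸ hg p hp⟩

/-- The case of even holes: every exit index is an apex on both sides or a leaf on both sides, the
tents of `S` correspond to those of `T` in the opposite order, and corresponding tents live in a
common tree. Then some two exit indices are joined up in both `T` and `S`. -/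
theorem exists_common_mates_of_coarboreal (C : CycleOn K H n) (P : T.Compat K H)
    (P' : S.Compat K H) (E : T.Exits K Q a) (E' : S.Exits K Q b) (hQ : Q.Nonempty) {m : ℕ}
    (hT : T.last = m) (hS : S.last = m) {base : ℕ → Finset ℕ}
    (hapex : ∀ p ∈ Q, p ≤ m → 1 ≤ p ∧ a p = T.apex p ∧ b p = S.apex (m + 1 - p))
    (hleaf : ∀ c ≤ m, ∀ p ∈ base c, T.IsLeaf c (a p) ∧ S.IsLeaf (m - c) (b p))
    (hbase : ∀ p ∈ Q, m < p → ∃ c ≤ m, p ∈ base c)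
    (hco : ∀ c ≤ m, (base c).Nonempty → Coarboreal (T.tent c) (S.tent (m - c))
      (fun p : base c => a p) (fun p : base c => b p)) :
    ∃ p ∈ Q, ∃ q ∈ Q, T.Mate K a p q ∧ S.Mate K b p q := by
  choose! f hfQ hf using fun p hp => E.exists_mate C P (p := p) hp
  choose! g hgQ hg using fun p hp => E'.exists_mate C P' (p := p) hp
  by_contra! hcon
  have hfg : ∀ p ∈ Q, f p ≠ g p := fun p hp e => hcon p hp (f p) (hfQ p hp) (hf p hp)
    (e ▸ hg p hp)
  have hfu : ∀ p ∈ Q, ∀ q ∈ Q, T.Mate K a p q → f p = q := fun p hp q hq h =>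
    (hf p hp).unique C E hp (hfQ p hp) hq h
  have hgu : ∀ p ∈ Q, ∀ q ∈ Q, S.Mate K b p q → g p = q := fun p hp q hq h =>
    (hg p hp).unique C E' hp (hgQ p hp) hq h
  have hff : ∀ p ∈ Q, f (f p) = p := fun p hp => hfu _ (hfQ p hp) _ hp (hf p hp).symm
  have hgg : ∀ p ∈ Q, g (g p) = p := fun p hp => hgu _ (hgQ p hp) _ hp (hg p hp).symm
  by_cases hsmall : ∃ i ∈ Q, i ≤ m
  · obtain ⟨i, hi, him⟩ := hsmall
    have hi1 := hapex i hi him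
    -- every other exit is adjacent to `i` on one of the two sides
    have hother : ∀ r ∈ Q, r ≠ i → f i = r ∨ g i = r := by
      intro r hr hri
      rcases le_or_gt r m with hrm | hrm
      · have hr1 := hapex r hr hrm
        exact Or.inl (hfu i hi r hr (E.mate_of_apexes C P hi hr hri.symm ⟨i, by omega, hi1.2.1⟩
          ⟨r, by omega, hr1.2.1⟩))
      · obtain ⟨c, hc, hrc⟩ := hbase r hr hrm
        obtain ⟨hl, hl'⟩ := hleaf c hc r hrc
        have haH := E.mem_cycle C hi
        have hbH := E'.mem_cycle C hi
        rcases le_or_gt i c with hic | hic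
        · left
          refine hfu i hi r hr ⟨hri.symm, Or.inl ?_⟩
          rw [hi1.2.1] at haH ⊢
          exact (P.adj_apex_leaf_iff (by omega) hl (E.mem_cycle C hr) haH).2 hic
        · right
          refine hgu i hi r hr ⟨hri.symm, Or.inl ?_⟩
          rw [hi1.2.2] at hbH ⊢
          exact (P'.adj_apex_leaf_iff (by omega) hl' (E'.mem_cycle C hr) hbH).2 (by omega)
    -- So every exit is one of `i`, `f i`, `g i`, whereas `g (f i)` is none of these.
    have hp := hfQ i hi
    have hpi := (hf i hi).1
    have h1 := (hg _ hp).1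
    rcases hother (g (f i)) (hgQ _ hp) (fun e => hfg i hi (by rw [← hgg _ hp, e])) with h2 | h2
    · exact h1 h2
    · exact hpi ((hgg _ hi).symm.trans ((congrArg g h2).trans (hgg _ hp)))
  · push Not at hsmall
    choose! τ hτm hτ using fun p hp => hbase p hp (hsmall p hp)
    have hl : ∀ p ∈ Q, T.IsLeaf (τ p) (a p) := fun p hp => (hleaf _ (hτm p hp) p (hτ p hp)).1
    have hl' : ∀ p ∈ Q, S.IsLeaf (m - τ p) (b p) :=
      fun p hp => (hleaf _ (hτm p hp) p (hτ p hp)).2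
    have hτu : ∀ p ∈ Q, ∀ c ≤ m, p ∈ base c → τ p = c := fun p hp c hc hpc =>
      eq_of_mem (hl p hp).1 (hT ▸ hc) (hl p hp).mem (hleaf c hc p hpc).1.mem
    have hT1 : ∀ p ∈ Q, ∀ r ∈ Q, τ p < τ (f p) → r ≠ p → r ≠ f p → τ r ≤ τ p :=
      fun p hp r hr hlt h1 h2 => (hf p hp).index_le C P E hp (hfQ p hp) hr (hl p hp)
        (hl _ (hfQ p hp)) (hl r hr) hlt h1 h2
    -- The tents of `S` run in the opposite order, so the inequality of `Mate.index_le` is reversed.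
    have hS1 : ∀ p ∈ Q, ∀ r ∈ Q, τ (g p) < τ p → r ≠ p → r ≠ g p → τ p ≤ τ r := by
      intro p hp r hr hlt h1 h2
      have h3 := hτm p hp
      have h4 := hτm r hr
      have := (hg p hp).index_le C P' E' hp (hgQ p hp) hr (hl' p hp)
        (hl' _ (hgQ p hp)) (hl' r hr) (by omega) h1 h2
      omega
    obtain ⟨p₀, hp₀, hmax⟩ : ∃ p ∈ Q, ∀ q ∈ Q, τ q ≤ τ p := by
      have hbdd : BddAbove (τ '' Q) := ⟨m, by rintro _ ⟨q, hq, rfl⟩; exact hτm q hq⟩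
      obtain ⟨q, hq, hqe⟩ := Nat.sSup_mem (hQ.image τ) hbdd
      exact ⟨q, hq, fun r hr => hqe ▸ le_csSup hbdd ⟨r, hr, rfl⟩⟩
    -- no pair of `f` leaves the last tent
    have hfM : ∀ p ∈ Q, τ (f p) = τ p₀ → τ p = τ p₀ := by
      intro p hp hq
      by_contra hne
      have hlt : τ p < τ (f p) := by have := hmax p hp; omega
      -- In `T`, the pair p, `f p` forces `g (f p)` into a tent no later than that of `p`. In `S`,
      -- the pair `f p`, `g (f p)` then forbids `p` from lying in a tent before that of `f p`.
      have hqQ := hfQ p hp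
      have hp'Q := hgQ _ hqQ
      have h1 : g (f p) ≠ p := fun e => hfg p hp (by rw [← hgg _ hqQ, e])
      have h2 := (hg _ hqQ).1
      have h3 := hT1 p hp _ hp'Q hlt h1 h2.symm
      have h4 := hS1 _ hqQ p hp (by omega) (hf p hp).1 h1.symm
      omega
    have hgM : ∀ p ∈ Q, τ (g p) = τ p₀ → τ p = τ p₀ := by
      intro p hp hq
      by_contra hne
      have hlt : τ p < τ (g p) := by have := hmax p hp; omega
      have hqQ := hgQ p hp
      -- The pair p, `g p` pushes `f p` into the last tent; as `f` preserves that tent, `p` is in it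
      -- too.
      have h5 := hS1 _ hqQ _ (hfQ p hp) (by rw [hgg p hp]; exact hlt) (hfg p hp)
        (by rw [hgg p hp]; exact (hf p hp).1.symm)
      have h6 := hmax _ (hfQ p hp)
      exact hne (hfM p hp (by omega))
    have hM := hτm p₀ hp₀
    obtain ⟨R, hR, hRT, hRS⟩ := hco (τ p₀) hM ⟨p₀, hτ p₀ hp₀⟩
    have hTc : τ p₀ ≤ T.last := by omega
    have hSc : m - τ p₀ ≤ S.last := by omega
    have : Nonempty U := ⟨a p₀⟩
    choose! v hv using fun p hp => (hf p hp).exists_mid C P (hl p hp) (hl _ (hfQ p hp))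
    choose! w hw using fun p hp => (hg p hp).exists_mid C P' (hl' p hp) (hl' _ (hgQ p hp))
    have hfmem : ∀ p ∈ Q, p ∈ base (τ p₀) → f p ∈ base (τ p₀) := by
      intro p hp hpb
      have := hfM _ (hfQ p hp) (by rw [hff p hp]; exact hτu p hp _ hM hpb)
      exact this ▸ hτ _ (hfQ p hp)
    have hgmem : ∀ p ∈ Q, p ∈ base (τ p₀) → g p ∈ base (τ p₀) := by
      intro p hp hpb
      have := hgM _ (hgQ p hp) (by rw [hgg p hp]; exact hτu p hp _ hM hpb)
      exact this ▸ hτ _ (hgQ p hp)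
    classical
    -- In the common tree of the last occurring tent and its partner, the subtree of a pair consists
    -- of the leaves below the vertex that joins the pair. By `Mid.eq_of_le`, subtrees of different
    -- pairs on the same side are disjoint.
    obtain ⟨⟨p, hpb⟩, hp, hpe⟩ := hR.exists_common_pair (Z := {x | (x : ℕ) ∈ Q})
      ⟨⟨p₀, hτ p₀ hp₀⟩, hp₀⟩
      (fun x => if h : (x : ℕ) ∈ Q then ⟨f x, hfmem x h x.2⟩ else x)
      (fun x => if h : (x : ℕ) ∈ Q then ⟨g x, hgmem x h x.2⟩ else x)
      (by
        rintro ⟨x, hx⟩ (hxQ : x ∈ Q)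
        simp only [hxQ, dif_pos]
        exact ⟨hfQ x hxQ, fun e => (hf x hxQ).1 (congrArg Subtype.val e).symm⟩)
      (by
        rintro ⟨x, hx⟩ (hxQ : x ∈ Q)
        simp only [hxQ, dif_pos]
        exact ⟨hgQ x hxQ, fun e => (hg x hxQ).1 (congrArg Subtype.val e).symm⟩)
      (fun x => {y | T.Le (v x) (a y)}) (fun x => {y | S.Le (w x) (b y)})
      (by
        rintro ⟨x, hx⟩ (hxQ : x ∈ Q)
        simp only [hxQ, dif_pos]
        exact ⟨connected_of_livesIn (leaf := fun y : base (τ p₀) => a y)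
          (x := ⟨x, hx⟩) hTc (fun y => (hleaf _ hM y y.2).1.mem) hRT
          (hv x hxQ).2.2.2.1, (hv x hxQ).2.2.2.1, (hv x hxQ).2.2.2.2⟩)
      (by
        rintro ⟨x, hx⟩ (hxQ : x ∈ Q)
        simp only [hxQ, dif_pos]
        exact ⟨connected_of_livesIn (leaf := fun y : base (τ p₀) => b y)
          (x := ⟨x, hx⟩) hSc (fun y => (hleaf _ hM y y.2).2.mem) hRS
          (hw x hxQ).2.2.2.1, (hw x hxQ).2.2.2.1, (hw x hxQ).2.2.2.2⟩)
      (by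
        rintro ⟨x, hx⟩ (hxQ : x ∈ Q) ⟨y, hy⟩ (hyQ : y ∈ Q) ⟨z, hz1, hz2⟩
        simp only [hxQ, dif_pos, Subtype.mk.injEq]
        obtain ⟨h1, h2, h3, -⟩ := hv x hxQ
        obtain ⟨h1', h2', h3', -⟩ := hv y hyQ
        have := h1.eq_of_le C P E h1' h2 ⟨_, h2'⟩ hz1 hz2
        rw [← this] at h2'
        rcases C.eq_or_eq (fun e => (hf x hxQ).1 (E.inj _ hxQ _ (hfQ x hxQ) e)) h2 h3 h2'
          with e | e
        · exact Or.inl (E.inj _ hyQ _ hxQ e)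
        · exact Or.inr (E.inj _ hyQ _ (hfQ x hxQ) e))
      (by
        rintro ⟨x, hx⟩ (hxQ : x ∈ Q) ⟨y, hy⟩ (hyQ : y ∈ Q) ⟨z, hz1, hz2⟩
        simp only [hxQ, dif_pos, Subtype.mk.injEq]
        obtain ⟨h1, h2, h3, -⟩ := hw x hxQ
        obtain ⟨h1', h2', h3', -⟩ := hw y hyQ
        have := h1.eq_of_le C P' E' h1' h2 ⟨_, h2'⟩ hz1 hz2
        rw [← this] at h2'
        rcases C.eq_or_eq (fun e => (hg x hxQ).1 (E'.inj _ hxQ _ (hgQ x hxQ) e)) h2 h3 h2'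
          with e | e
        · exact Or.inl (E'.inj _ hyQ _ hxQ e)
        · exact Or.inr (E'.inj _ hyQ _ (hgQ x hxQ) e))
    have hpQ : p ∈ Q := hp
    simp only [hpQ, dif_pos, Subtype.mk.injEq] at hpe
    exact hfg p hpQ hpe

end TentTree

/-! ### Interleaved families of intervals. -/

/-- The order structure of two families of intervals: the minimum of each interval of the first
family is an index of the second family, the maximum of each interval of the second family is an
index of the first one, and one innermost interval may be exempt. -/
theorem lt_iff_le_of_interleaved {A B : Finset ℕ} {I J : ℕ → Finset ℕ} (hA0 : 0 ∈ A)
    (hI : ∀ i ∈ A, ∀ i' ∈ A, i < i' → ∀ p ∈ I i, ∀ q ∈ I i', q < p)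
    (hJ : ∀ j ∈ B, ∀ j' ∈ B, j < j' → ∀ p ∈ J j, ∀ q ∈ J j', q < p)
    (hJ0 : ∀ j ∈ B, ∀ i ∈ J j, i ≠ 0)
    (hup : ∀ i ∈ A, ¬ (Odd (A.card + B.card) ∧ ∀ i' ∈ A, i' ≤ i) →
      ∃ j ∈ B, IsLeast (I i : Set ℕ) j)
    (hlow : ∀ j ∈ B, ¬ (Even (A.card + B.card) ∧ ∀ j' ∈ B, j ≤ j') →
      ∃ i ∈ A, IsGreatest (J j : Set ℕ) i)
    {i p σ τ : ℕ} (hσ : σ ∈ B) (hi : i ∈ J σ) (hτ : τ ∈ A) (hp : p ∈ I τ) :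
    p < σ ↔ i ≤ τ := by
  classical
  -- `DA` and `DB` are the indices that are not exempt. Below, `f` takes minima of the `I i` and `g`
  -- takes maxima of the `J j`; both are strictly decreasing because the intervals are.
  set DA := A.filter fun i => ¬ (Odd (A.card + B.card) ∧ ∀ i' ∈ A, i' ≤ i) with hDA
  set DB := B.filter fun j => ¬ (Even (A.card + B.card) ∧ ∀ j' ∈ B, j ≤ j') with hDB
  have hup' : ∀ i ∈ DA, ∃ j ∈ B, IsLeast (I i : Set ℕ) j := fun i hi =>
    hup i (Finset.mem_filter.1 hi).1 (Finset.mem_filter.1 hi).2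
  have hlow' : ∀ j ∈ DB, ∃ i ∈ A, IsGreatest (J j : Set ℕ) i := fun j hj =>
    hlow j (Finset.mem_filter.1 hj).1 (Finset.mem_filter.1 hj).2
  choose! f hfB hf using hup'
  choose! g hgA hg using hlow'
  have hDAA : ∀ i ∈ DA, i ∈ A := fun i hi => (Finset.mem_filter.1 hi).1
  have hDBB : ∀ i ∈ DB, i ∈ B := fun i hi => (Finset.mem_filter.1 hi).1
  have hflt : ∀ x ∈ DA, ∀ y ∈ DA, x < y → f y < f x := fun x hx y hy hxy =>
    hI x (hDAA x hx) y (hDAA y hy) hxy _ (hf x hx).1 _ (hf y hy).1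
  have hglt : ∀ x ∈ DB, ∀ y ∈ DB, x < y → g y < g x := fun x hx y hy hxy =>
    hJ x (hDBB x hx) y (hDBB y hy) hxy _ (hg x hx).1 _ (hg y hy).1
  have hfinj : Set.InjOn f DA := by
    intro x hx y hy e
    rcases lt_trichotomy x y with h | h | h
    · have := hflt x hx y hy h; omega
    · exact h
    · have := hflt y hy x hx h; omega
  have hginj : Set.InjOn g DB := by
    intro x hx y hy e
    rcases lt_trichotomy x y with h | h | h
    · have := hglt x hx y hy h; omega
    · exact h
    · have := hglt y hy x hx h; omega
  have hgne : ∀ x ∈ DB, g x ∈ A.erase 0 := fun x hx =>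
    Finset.mem_erase.2 ⟨hJ0 x (hDBB x hx) _ (hg x hx).1, hgA x hx⟩
  have hfim : DA.image f ⊆ B := Finset.image_subset_iff.2 hfB
  have hgim : DB.image g ⊆ A.erase 0 := Finset.image_subset_iff.2 hgne
  have hc1 : DA.card ≤ B.card := by
    rw [← Finset.card_image_of_injOn hfinj]; exact Finset.card_le_card hfim
  have hc2 : DB.card ≤ A.card - 1 := by
    rw [← Finset.card_image_of_injOn hginj, ← Finset.card_erase_of_mem hA0]
    exact Finset.card_le_card hgim
  have hApos : 1 ≤ A.card := Finset.card_pos.2 ⟨0, hA0⟩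
  -- With an even total, |A| = |DA| ≤ |B| and |B| - 1 ≤ |DB| ≤ |A| - 1. With an odd total, |A| - 1 ≤
  -- |DA| ≤ |B| = |DB| ≤ |A| - 1. Either way `f` maps onto `B`, and `g` onto `A` without 0.
  have hcard : B.card ≤ DA.card ∧ A.card - 1 ≤ DB.card := by
    rcases Nat.even_or_odd (A.card + B.card) with he | ho
    · have h1 : DA = A := Finset.filter_true_of_mem fun x _ h =>
        (Nat.not_odd_iff_even.2 he) h.1
      have h2 : B.card - 1 ≤ DB.card := by
        rcases B.eq_empty_or_nonempty with rfl | hne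
        · simp
        · rw [← Finset.card_erase_of_mem (B.min'_mem hne)]
          refine Finset.card_le_card fun x hx => ?_
          rw [Finset.mem_erase] at hx
          refine Finset.mem_filter.2 ⟨hx.2, fun h => hx.1 ?_⟩
          exact le_antisymm (h.2 _ (B.min'_mem hne)) (B.min'_le x hx.2)
      rw [h1] at hc1 ⊢
      omega
    · have h1 : DB = B := Finset.filter_true_of_mem fun x _ h =>
        (Nat.not_even_iff_odd.2 ho) h.1
      have h2 : A.card - 1 ≤ DA.card := by
        rw [← Finset.card_erase_of_mem (A.max'_mem ⟨0, hA0⟩)]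
        refine Finset.card_le_card fun x hx => ?_
        rw [Finset.mem_erase] at hx
        refine Finset.mem_filter.2 ⟨hx.2, fun h => hx.1 ?_⟩
        exact le_antisymm (A.le_max' x hx.2) (h.2 _ (A.max'_mem ⟨0, hA0⟩))
      rw [h1] at hc2 ⊢
      omega
  have hfsurj : ∀ y ∈ B, ∃ x ∈ DA, f x = y := by
    have : DA.image f = B := Finset.eq_of_subset_of_card_le hfim
      (by rw [Finset.card_image_of_injOn hfinj]; exact hcard.1)
    intro y hy
    rw [← this] at hy
    exact Finset.mem_image.1 hy
  have hgsurj : ∀ y ∈ A, y ≠ 0 → ∃ x ∈ DB, g x = y := by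
    have : DB.image g = A.erase 0 := Finset.eq_of_subset_of_card_le hgim
      (by rw [Finset.card_image_of_injOn hginj, Finset.card_erase_of_mem hA0]; exact hcard.2)
    intro y hy hy0
    have hy' := Finset.mem_erase.2 ⟨hy0, hy⟩
    rw [← this] at hy'
    exact Finset.mem_image.1 hy'
  -- `g ∘ f` is the successor map of `A`
  have hsucc : ∀ x ∈ DA, f x ∈ DB → ∀ y ∈ A, y < g (f x) ↔ y ≤ x := by
    intro x hx hfx
    have hltDA : ∀ y ∈ A, y < x → y ∈ DA := fun y hy hyx =>
      Finset.mem_filter.2 ⟨hy, fun h => absurd (h.2 x (hDAA x hx)) (by omega)⟩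
    have hltDB : ∀ y ∈ A, y < x → f y ∈ DB := fun y hy hyx =>
      Finset.mem_filter.2 ⟨hfB y (hltDA y hy hyx), fun h => by
        have h1 := h.2 _ (hfB x hx)
        have h2 := hflt y (hltDA y hy hyx) x hx hyx
        omega⟩
    -- Since `g ∘ f` is increasing and reaches every nonzero element of `A`, the part of `A` below
    -- `g (f x)` is 0 together with the images of the elements below `x`. It has as many elements as
    -- the part of `A` up to `x`, and two initial segments of equal size coincide.
    have hset : A.filter (· < g (f x)) =
        insert 0 ((A.filter (· < x)).image fun y => g (f y)) := by
      ext z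
      rw [Finset.mem_filter, Finset.mem_insert, Finset.mem_image]
      constructor
      · rintro ⟨hz, hlt⟩
        by_cases hz0 : z = 0
        · exact Or.inl hz0
        right
        obtain ⟨s, hs, rfl⟩ := hgsurj z hz hz0
        obtain ⟨y, hy, rfl⟩ := hfsurj s (hDBB s hs)
        refine ⟨y, Finset.mem_filter.2 ⟨hDAA y hy, ?_⟩, rfl⟩
        by_contra hyx
        rcases (not_lt.1 hyx).lt_or_eq with h | rfl
        · have := hglt _ hs _ hfx (hflt _ hx _ hy h)
          omega
        · omega
      · rintro (rfl | ⟨y, hy, rfl⟩)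
        · have := (Finset.mem_erase.1 (hgne _ hfx)).1
          exact ⟨hA0, by omega⟩
        · obtain ⟨hy, hyx⟩ := Finset.mem_filter.1 hy
          exact ⟨hgA _ (hltDB y hy hyx), hglt _ hfx _ (hltDB y hy hyx)
            (hflt y (hltDA y hy hyx) x hx hyx)⟩
    have hc : (A.filter (· < g (f x))).card = (A.filter (· ≤ x)).card := by
      have h1 : A.filter (· ≤ x) = insert x (A.filter (· < x)) := by
        ext z
        rw [Finset.mem_filter, Finset.mem_insert, Finset.mem_filter]
        constructor
        · rintro ⟨hz, hzx⟩
          rcases hzx.lt_or_eq with h | h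
          · exact Or.inr ⟨hz, h⟩
          · exact Or.inl h
        · rintro (rfl | ⟨hz, hzx⟩)
          · exact ⟨hDAA z hx, le_rfl⟩
          · exact ⟨hz, hzx.le⟩
      rw [hset, h1, Finset.card_insert_of_notMem, Finset.card_insert_of_notMem,
        Finset.card_image_of_injOn]
      · intro y hy z hz e
        obtain ⟨hy, hyx⟩ := Finset.mem_filter.1 hy
        obtain ⟨hz, hzx⟩ := Finset.mem_filter.1 hz
        exact hfinj (hltDA y hy hyx) (hltDA z hz hzx)
          (hginj (hltDB y hy hyx) (hltDB z hz hzx) e)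
      · simp
      · intro h0
        obtain ⟨y, hy, hy0⟩ := Finset.mem_image.1 h0
        obtain ⟨hy, hyx⟩ := Finset.mem_filter.1 hy
        exact (Finset.mem_erase.1 (hgne _ (hltDB y hy hyx))).1 hy0
    have hxlt : x < g (f x) := by
      by_contra hle
      have hsub : A.filter (· < g (f x)) ⊆ (A.filter (· ≤ x)).erase x := by
        intro z hz
        obtain ⟨hz, hzx⟩ := Finset.mem_filter.1 hz
        exact Finset.mem_erase.2 ⟨by omega, Finset.mem_filter.2 ⟨hz, by omega⟩⟩
      have h1 := Finset.card_le_card hsub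
      have hxm : x ∈ A.filter (· ≤ x) := Finset.mem_filter.2 ⟨hDAA x hx, le_rfl⟩
      rw [Finset.card_erase_of_mem hxm] at h1
      have h2 := Finset.card_pos.2 ⟨x, hxm⟩
      omega
    have heq : A.filter (· ≤ x) = A.filter (· < g (f x)) := by
      refine Finset.eq_of_subset_of_card_le (fun z hz => ?_) hc.le
      obtain ⟨hz, hzx⟩ := Finset.mem_filter.1 hz
      exact Finset.mem_filter.2 ⟨hz, by omega⟩
    intro y hy
    have := Finset.ext_iff.1 heq y
    rw [Finset.mem_filter, Finset.mem_filter] at this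
    tauto
  obtain ⟨τ', hτ', rfl⟩ := hfsurj σ hσ
  -- `σ = f τ'` is the minimum of `I τ'`, and later intervals lie lower.
  have hleft : p < f τ' ↔ τ' < τ := by
    constructor
    · intro hlt
      by_contra hle
      rcases (not_lt.1 hle).lt_or_eq with h | rfl
      · have := hI τ hτ τ' (hDAA _ hτ') h p hp _ (hf _ hτ').1
        omega
      · have := (hf _ hτ').2 hp
        omega
    · intro hlt
      exact hI _ (hDAA _ hτ') _ hτ hlt _ (hf _ hτ').1 _ hp
  rw [hleft]
  by_cases hτ0 : τ = 0
  · have := hJ0 _ hσ _ hi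
    omega
  obtain ⟨s, hs, rfl⟩ := hgsurj τ hτ hτ0
  obtain ⟨t, ht, rfl⟩ := hfsurj s (hDBB s hs)
  rw [hsucc t ht hs τ' (hDAA _ hτ')]
  constructor
  · intro hle
    rcases hle.lt_or_eq with h | rfl
    · exact (hJ _ (hDBB _ hs) _ hσ (hflt _ hτ' _ ht h) _ (hg _ hs).1 _ hi).le
    · exact (hg _ hs).2 hi
  · intro hle
    by_contra hlt
    have := hJ _ hσ _ (hDBB _ hs) (hflt _ ht _ hτ' (not_le.1 hlt)) _ hi _ (hg _ hs).1
    omega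

/-! ### The two arborescences of a framework as sequences of tents. -/

namespace Framework

variable {ℓ : ℕ} {U : Type*} (F : Framework ℓ U)

/-- The index of the last tent of the lower arborescence, counted from its apex. -/
def lowerLast : ℕ := if Odd ℓ then F.k - F.m - 1 else F.m

/-- The index of the apex of the `c`-th tent of the lower arborescence, counted from its apex. -/
def lowerIndex (c : ℕ) : ℕ := if Odd ℓ then F.k - c else if c = 0 then 0 else F.m + 1 - c

theorem mem_upperBase {i p : ℕ} (hi : i ≤ F.m) (hp : p ∈ F.upperBase i) : F.m + 1 ≤ p ∧ p ≤ F.k :=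
  Finset.mem_Icc.1 ((F.upper_cover p).2 ⟨i, hi, hp⟩)

theorem m_lt_k : F.m < F.k := by
  obtain ⟨p, hp⟩ := F.upper_zero
  have := F.mem_upperBase (Nat.zero_le _) hp
  omega

theorem lowerIndex_mem {c : ℕ} (hc : c ≤ F.lowerLast) : F.lowerIndex c ∈ F.lowerSpine := by
  have := F.m_lt_k
  unfold lowerLast at hc
  unfold lowerIndex FrameworkData.lowerSpine
  split_ifs at * <;> rw [Finset.mem_Icc] <;> omega

theorem lowerIndex_inj {c c' : ℕ} (hc : c ≤ F.lowerLast) (hc' : c' ≤ F.lowerLast)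
    (h : F.lowerIndex c = F.lowerIndex c') : c = c' := by
  have := F.m_lt_k
  unfold lowerLast at hc hc'
  unfold lowerIndex at h
  split_ifs at * <;> omega

theorem exists_lowerIndex {j : ℕ} (hj : j ∈ F.lowerSpine) :
    ∃ c ≤ F.lowerLast, F.lowerIndex c = j := by
  have := F.m_lt_k
  unfold FrameworkData.lowerSpine at hj
  unfold lowerLast lowerIndex
  split_ifs at * <;> rw [Finset.mem_Icc] at hj
  · exact ⟨F.k - j, by omega, by omega⟩
  · by_cases h0 : j = 0
    · exact ⟨0, by omega, by simp [h0]⟩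
    · refine ⟨F.m + 1 - j, by omega, ?_⟩
      rw [if_neg (by omega)]
      omega

/-- Renumbering the lower tents from the root turns both parity conventions into one successor
relation. -/
theorem lowerNext_iff {j i : ℕ} : F.LowerNext j i ↔
    ∃ c < F.lowerLast, j = F.lowerIndex c ∧ i = F.lowerIndex (c + 1) := by
  have := F.m_lt_k
  unfold FrameworkData.LowerNext lowerLast lowerIndex
  by_cases ho : Odd ℓ
  · simp only [if_pos ho]
    constructor
    · rintro ⟨h1, h2, rfl⟩
      exact ⟨F.k - (i + 1), by omega, by omega, by omega⟩
    · rintro ⟨c, hc, rfl, rfl⟩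
      omega
  · simp only [if_neg ho, Nat.add_eq_zero_iff, one_ne_zero, and_false, if_false]
    constructor
    · rintro (⟨h1, h2, rfl⟩ | ⟨h1, rfl, rfl⟩)
      · refine ⟨F.m - i, by omega, ?_, by omega⟩
        rw [if_neg (by omega)]
        omega
      · exact ⟨0, by omega, by simp, by omega⟩
    · rintro ⟨c, hc, rfl, rfl⟩
      split_ifs with h0
      · right; omega
      · left; omega

/-- The upper arborescence. -/
def upperTree : TentTree U where
  last := F.m
  tent := F.upper
  joint := F.upperJoint
  disjoint := F.upper_disjoint
  joint_mem i hi := (F.upper_joint i hi).1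
  joint_not_leaf i hi := (F.upper_joint i hi).2

/-- The lower arborescence. -/
def lowerTree : TentTree U where
  last := F.lowerLast
  tent c := F.lower (F.lowerIndex c)
  joint c := F.lowerJoint (F.lowerIndex c)
  disjoint _ hc _ hc' h := F.lower_disjoint _ (F.lowerIndex_mem hc) _ (F.lowerIndex_mem hc')
    fun e => h (F.lowerIndex_inj hc hc' e)
  joint_mem c hc := (F.lower_joint _ _ (F.lowerNext_iff.2 ⟨c, hc, rfl, rfl⟩)).1
  joint_not_leaf c hc := (F.lower_joint _ _ (F.lowerNext_iff.2 ⟨c, hc, rfl, rfl⟩)).2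

theorem upperTree_apex {i : ℕ} (hi : i ≤ F.m) : F.upperTree.apex i = F.a i := F.upper_apex i hi

theorem lowerTree_apex {c : ℕ} (hc : c ≤ F.lowerLast) :
    F.lowerTree.apex c = F.b (F.lowerIndex c) :=
  F.lower_apex _ (F.lowerIndex_mem hc)

theorem lowerTree_verts : F.lowerTree.verts = F.lowerVerts := by
  ext u
  constructor
  · rintro ⟨c, hc, hu⟩
    exact ⟨_, F.lowerIndex_mem hc, hu⟩
  · rintro ⟨j, hj, hu⟩
    obtain ⟨c, hc, rfl⟩ := F.exists_lowerIndex hj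
    exact ⟨c, hc, hu⟩

theorem upperTree_arc : F.upperTree.Arc = F.UpperArc := by
  ext u v
  refine or_congr Iff.rfl
    (exists_congr fun i => and_congr_right fun hi => and_congr_right fun _ => ?_)
  rw [F.upperTree_apex hi]

theorem lowerTree_arc : F.lowerTree.Arc = F.LowerArc := by
  ext u v
  refine or_congr ⟨?_, ?_⟩ ⟨?_, ?_⟩
  · rintro ⟨c, hc, h⟩
    exact ⟨_, F.lowerIndex_mem hc, h⟩
  · rintro ⟨j, hj, h⟩
    obtain ⟨c, hc, rfl⟩ := F.exists_lowerIndex hj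
    exact ⟨c, hc, h⟩
  · rintro ⟨c, hc, rfl, rfl⟩
    exact ⟨_, _, F.lowerNext_iff.2 ⟨c, hc, rfl, rfl⟩, rfl, F.lowerTree_apex hc⟩
  · rintro ⟨j, i, hji, rfl, rfl⟩
    obtain ⟨c, hc, rfl, rfl⟩ := F.lowerNext_iff.1 hji
    exact ⟨c, hc, rfl, (F.lowerTree_apex hc).symm⟩

theorem lowerRoot_eq : F.lowerRoot = F.lowerTree.apex 0 := by
  rw [F.lowerTree_apex (Nat.zero_le _)]
  unfold FrameworkData.lowerRoot lowerIndex
  by_cases ho : Odd ℓ <;> simp [ho]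

theorem isLeaf_upper {i p : ℕ} (hi : i ≤ F.m) (hp : p ∈ F.upperBase i) :
    F.upperTree.IsLeaf i (F.a p) := by
  refine ⟨hi, ?_⟩
  change F.a p ∈ (F.upper i).leaves
  rw [F.upper_leaves i hi]
  exact ⟨p, hp, rfl⟩

theorem isLeaf_lower {c p : ℕ} (hc : c ≤ F.lowerLast) (hp : p ∈ F.lowerBase (F.lowerIndex c)) :
    F.lowerTree.IsLeaf c (F.b p) := by
  refine ⟨hc, ?_⟩
  change F.b p ∈ (F.lower (F.lowerIndex c)).leaves
  rw [F.lower_leaves _ (F.lowerIndex_mem hc)]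
  exact ⟨p, hp, rfl⟩

theorem upper_cases {p : ℕ} (hp : p ∈ Finset.Icc 1 F.k) :
    p ≤ F.m ∨ (F.m < p ∧ ∃ i ≤ F.m, p ∈ F.upperBase i) := by
  rw [Finset.mem_Icc] at hp
  rcases le_or_gt p F.m with h | h
  · exact Or.inl h
  · exact Or.inr ⟨h, (F.upper_cover p).1 (Finset.mem_Icc.2 ⟨h, hp.2⟩)⟩

/-- The partner of `T_i` is `S_{i+1}`, or `S_0` when `i = m`. Counted from the root of `S` its
position is `m - i`, so partners occur in opposite orders. -/
theorem even_lowerBase (he : ¬ Odd ℓ) {c : ℕ} (hc : c ≤ F.m) :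
    F.lowerBase (F.lowerIndex c) = F.upperBase (F.m - c) := by
  have := F.even_pairing (Nat.not_odd_iff_even.1 he) (F.m - c) (Nat.sub_le _ _)
  rw [← this]
  congr 1
  unfold lowerIndex
  split_ifs <;> omega

/-- Every path ends in an apex or a leaf of the lower arborescence. -/
theorem lower_cases {p : ℕ} (hp : p ∈ Finset.Icc 1 F.k) :
    (∃ c ≤ F.lowerLast, F.b p = F.lowerTree.apex c) ∨
      ∃ c ≤ F.lowerLast, F.lowerTree.IsLeaf c (F.b p) := by
  by_cases hs : p ∈ F.lowerSpine
  · obtain ⟨c, hc, rfl⟩ := F.exists_lowerIndex hs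
    exact Or.inl ⟨c, hc, (F.lowerTree_apex hc).symm⟩
  right
  rw [Finset.mem_Icc] at hp
  by_cases ho : Odd ℓ
  · have hpm : p ∈ Finset.Icc 1 F.m := by
      rw [FrameworkData.lowerSpine, if_pos ho, Finset.mem_Icc] at hs
      rw [Finset.mem_Icc]
      omega
    obtain ⟨j, hj, hpj⟩ := (F.odd_lower_cover ho p).1 hpm
    obtain ⟨c, hc, rfl⟩ := F.exists_lowerIndex (j := j)
      (by rw [FrameworkData.lowerSpine, if_pos ho]; exact hj)
    exact ⟨c, hc, F.isLeaf_lower hc hpj⟩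
  · rw [FrameworkData.lowerSpine, if_neg ho, Finset.mem_Icc] at hs
    obtain ⟨i, hi, hpi⟩ := (F.upper_cover p).1 (Finset.mem_Icc.2 ⟨by omega, hp.2⟩)
    have hlast : F.lowerLast = F.m := if_neg ho
    refine ⟨F.m - i, by omega, F.isLeaf_lower (by omega) ?_⟩
    rw [F.even_lowerBase ho (Nat.sub_le _ _), Nat.sub_sub_self hi]
    exact hpi

theorem a_mem {p : ℕ} (hp : p ∈ Finset.Icc 1 F.k) : F.a p ∈ F.upperTree.verts := by
  rcases F.upper_cases hp with h | ⟨-, i, hi, hpi⟩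
  · rw [← F.upperTree_apex h]
    exact TentTree.mem_verts h TentTree.apex_mem
  · exact TentTree.mem_verts hi (F.isLeaf_upper hi hpi).mem

theorem b_mem {p : ℕ} (hp : p ∈ Finset.Icc 1 F.k) : F.b p ∈ F.lowerTree.verts := by
  rcases F.lower_cases hp with ⟨c, hc, h⟩ | ⟨c, hc, h⟩
  · rw [h]
    exact TentTree.mem_verts hc TentTree.apex_mem
  · exact TentTree.mem_verts hc h.mem

theorem barLength_pos (hℓ : 5 ≤ ℓ) (p : ℕ) : 1 ≤ F.barLength p := by
  unfold FrameworkData.barLength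
  split_ifs with h
  · omega
  · omega
  · rw [Nat.not_odd_iff_even] at h
    obtain ⟨x, rfl⟩ := h
    omega

theorem closureGraph_adj_cases {u v : U} (h : F.closureGraph.Adj u v) :
    (u ∈ F.upperTree.verts ∧ v ∈ F.upperTree.verts ∧ (F.upperTree.Le u v ∨ F.upperTree.Le v u)) ∨
    (u ∈ F.lowerTree.verts ∧ v ∈ F.lowerTree.verts ∧ (F.lowerTree.Le u v ∨ F.lowerTree.Le v u)) ∨
    F.BarStep u v ∨ F.BarStep v u := by
  rw [FrameworkData.closureGraph, SimpleGraph.fromRel_adj, ← upperTree_arc, ← lowerTree_arc] at h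
  obtain ⟨hne, (h | h | h) | (h | h | h)⟩ := h
  · have := TentTree.Le.mem_of_ne (T := F.upperTree) h hne
    exact Or.inl ⟨this.1, this.2, Or.inl h⟩
  · have := TentTree.Le.mem_of_ne (T := F.lowerTree) h hne
    exact Or.inr (Or.inl ⟨this.1, this.2, Or.inl h⟩)
  · exact Or.inr (Or.inr (Or.inl h))
  · have := TentTree.Le.mem_of_ne (T := F.upperTree) h hne.symm
    exact Or.inl ⟨this.2, this.1, Or.inr h⟩
  · have := TentTree.Le.mem_of_ne (T := F.lowerTree) h hne.symm
    exact Or.inr (Or.inl ⟨this.2, this.1, Or.inr h⟩)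
  · exact Or.inr (Or.inr (Or.inr h))

theorem not_barStep_upper {u v : U} (hv : v ∈ F.upperTree.verts) : ¬ F.BarStep u v := by
  rintro ⟨i, hi, s, hs, rfl, rfl⟩
  exact absurd (F.bar_upper i hi (s + 1) hs hv) (Nat.succ_ne_zero s)

theorem not_barStep_lower {u v : U} (hu : u ∈ F.lowerTree.verts) : ¬ F.BarStep u v := by
  rintro ⟨i, hi, s, hs, rfl, rfl⟩
  rw [lowerTree_verts] at hu
  exact absurd (F.bar_lower i hi s hs.le hu) hs.ne

theorem disjoint_trees : Disjoint F.upperTree.verts F.lowerTree.verts := by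
  rw [lowerTree_verts]
  exact F.upper_lower_disjoint

/-- A path `P_i` meets the upper arborescence only in its first vertex, so no edge of a path lies
inside it. -/
theorem closureGraph_adj_upper {u v : U} (hu : u ∈ F.upperTree.verts) (hv : v ∈ F.upperTree.verts) :
    F.closureGraph.Adj u v ↔ u ≠ v ∧ (F.upperTree.Le u v ∨ F.upperTree.Le v u) := by
  constructor
  · intro h
    rcases F.closureGraph_adj_cases h with h1 | h1 | h1 | h1
    · exact ⟨h.ne, h1.2.2⟩
    · exact absurd h1.1 (Set.disjoint_left.1 F.disjoint_trees hu)
    · exact absurd h1 (F.not_barStep_upper hv)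
    · exact absurd h1 (F.not_barStep_upper hu)
  · rintro ⟨hne, h⟩
    rw [FrameworkData.closureGraph, SimpleGraph.fromRel_adj, ← upperTree_arc]
    exact ⟨hne, h.imp Or.inl Or.inl⟩

theorem closureGraph_adj_lower {u v : U} (hu : u ∈ F.lowerTree.verts) (hv : v ∈ F.lowerTree.verts) :
    F.closureGraph.Adj u v ↔ u ≠ v ∧ (F.lowerTree.Le u v ∨ F.lowerTree.Le v u) := by
  constructor
  · intro h
    rcases F.closureGraph_adj_cases h with h1 | h1 | h1 | h1
    · exact absurd hu (Set.disjoint_left.1 F.disjoint_trees h1.1)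
    · exact ⟨h.ne, h1.2.2⟩
    · exact absurd h1 (F.not_barStep_lower hu)
    · exact absurd h1 (F.not_barStep_lower hv)
  · rintro ⟨hne, h⟩
    rw [FrameworkData.closureGraph, SimpleGraph.fromRel_adj, ← lowerTree_arc]
    exact ⟨hne, h.imp (Or.inr ∘ Or.inl) (Or.inr ∘ Or.inl)⟩

theorem barSystem (hℓ : 5 ≤ ℓ) {K : SimpleGraph U} (hK : ∀ u v, K.Adj u v → F.closureGraph.Adj u v) :
    BarSystem F.upperTree F.lowerTree K (Finset.Icc 1 F.k : Finset ℕ) F.bar F.barLength where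
  len_pos p _ := F.barLength_pos hℓ p
  inj := F.bar_inj
  first_mem p hp := F.bar_first p hp ▸ F.a_mem hp
  last_mem p hp := F.bar_last p hp ▸ F.b_mem hp
  eq_first := F.bar_upper
  eq_last := F.lowerTree_verts ▸ F.bar_lower
  disjoint := F.disjoint_trees
  cover u := F.lowerTree_verts ▸ F.vertex_cases u
  adj u v h := by
    rcases F.closureGraph_adj_cases (hK u v h) with h1 | h1 | h1 | h1
    · exact Or.inl ⟨h1.1, h1.2.1⟩
    · exact Or.inr (Or.inl ⟨h1.1, h1.2.1⟩)
    · exact Or.inr (Or.inr (Or.inl h1))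
    · obtain ⟨i, hi, s, hs, rfl, rfl⟩ := h1
      exact Or.inr (Or.inr (Or.inr ⟨i, hi, s, hs, rfl, rfl⟩))

end Framework

/-! ### Holes of blow-ups of frameworks. -/

namespace Framework

variable {ℓ : ℕ} {U V : Type*} {F : Framework ℓ U} {G : SimpleGraph V}

/-- Bags with more than one vertex belong to vertices of paths. In the upper arborescence these are
the `a i`, each of which is an apex or a leaf of a tent. -/
theorem Blowup.compat_upper (B : F.Blowup G) {τ : V → U} (hτ : ∀ v t, v ∈ B.bag t ↔ τ v = t) {n : ℕ}
    (c : SimpleGraph.cycleGraph n ↪g G) (hinj : Function.Injective (τ ∘ c)) :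
    F.upperTree.Compat ((SimpleGraph.cycleGraph n).map (τ ∘ c)) (Set.range (τ ∘ c)) := by
  refine TentTree.compat_of_bags _ B.emb B.bag τ hτ B.bag_nonadj
    (fun u hu v hv => F.closureGraph_adj_upper hu hv) ?_ ?_ ?_ c hinj
  · intro u hu hnl hna
    refine B.bag_trivial u ?_
    rintro ⟨i, hi, s, hs, rfl⟩
    obtain rfl := F.bar_upper i hi s hs hu
    rw [F.bar_first i hi] at hnl hna
    rcases F.upper_cases hi with h | ⟨-, d, hd, hid⟩
    · exact hna i h (F.upperTree_apex h).symm
    · exact hnl d (F.isLeaf_upper hd hid)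
  · intro t ht d hd hadj
    rw [F.upperTree_apex hd] at hadj ⊢
    exact B.complete_upper t ht d hd hadj
  · intro d hd t ht
    rw [F.upperTree_apex hd, F.upperTree_apex (Nat.zero_le _), F.upperTree_arc]
    exact B.upper_tent d hd t ht

theorem Blowup.compat_lower (B : F.Blowup G) {τ : V → U} (hτ : ∀ v t, v ∈ B.bag t ↔ τ v = t) {n : ℕ}
    (c : SimpleGraph.cycleGraph n ↪g G) (hinj : Function.Injective (τ ∘ c)) :
    F.lowerTree.Compat ((SimpleGraph.cycleGraph n).map (τ ∘ c)) (Set.range (τ ∘ c)) := by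
  refine TentTree.compat_of_bags _ B.emb B.bag τ hτ B.bag_nonadj
    (fun u hu v hv => F.closureGraph_adj_lower hu hv) ?_ ?_ ?_ c hinj
  · intro u hu hnl hna
    refine B.bag_trivial u ?_
    rintro ⟨i, hi, s, hs, rfl⟩
    obtain rfl := F.bar_lower i hi s hs (F.lowerTree_verts ▸ hu)
    rw [F.bar_last i hi] at hnl hna
    rcases F.lower_cases hi with ⟨d, hd, h⟩ | ⟨d, hd, h⟩
    · exact hna d hd h
    · exact hnl d h
  · intro t ht d hd hadj
    rw [F.lowerTree_apex hd] at hadj ⊢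
    exact B.complete_lower t (F.lowerTree_verts ▸ ht) _ (F.lowerIndex_mem hd) hadj
  · intro d hd t ht
    rw [F.lowerTree_apex hd, ← F.lowerRoot_eq, F.lowerTree_arc, F.lowerTree_verts]
    exact B.lower_tent _ (F.lowerIndex_mem hd) t ht

/-- A hole of a blow-up meets each bag at most once. -/
theorem Blowup.injective_comp (B : F.Blowup G) {τ : V → U} (hτ : ∀ v t, v ∈ B.bag t ↔ τ v = t)
    {n : ℕ} (hn : 4 ≤ n) (c : SimpleGraph.cycleGraph n ↪g G) : Function.Injective (τ ∘ c) := by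
  refine injective_comp_of_dominated hn c τ ?_ ?_
  · intro x y hxy hne
    exact B.bag_clique (τ x) ((hτ x _).2 rfl) ((hτ y _).2 hxy.symm) hne
  · intro x y hxy
    have hobey : ∀ z, τ z = τ x → ∀ w, τ w ≠ τ x → G.Adj z w →
        Obeys G (B.bag (τ x)) (B.bag (τ w)) := by
      intro z hz w hw hadj
      have : F.closureGraph.Adj (τ x) (τ w) := by
        by_contra hn
        exact B.bag_nonadj _ _ (Ne.symm hw) hn z ((hτ z _).2 hz) w ((hτ w _).2 rfl) hadj
      exact (B.bag_adj _ _ this).1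
    -- Of two vertices of one bag, the earlier in its ordering dominates.
    obtain ⟨i, hi⟩ := List.mem_iff_get.1 ((hτ x (τ x)).2 rfl)
    obtain ⟨j, hj⟩ := List.mem_iff_get.1 ((hτ y (τ x)).2 hxy.symm)
    rcases le_total i j with hij | hij
    · left
      intro w hw hadj
      rw [← hi]
      exact (hobey y hxy.symm w hw hadj).adj_of_le hij ((hτ w _).2 rfl) (by rw [hj]; exact hadj)
    · right
      intro w hw hadj
      rw [← hj]
      exact (hobey x rfl w hw hadj).adj_of_le hij ((hτ w _).2 rfl) (by rw [hi]; exact hadj)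

/-- In an odd framework, exactly one of the two ends of a path from an upper apex is joined to the
corresponding end of a path from a lower apex. -/
theorem lt_iff_le_of_odd (F : Framework ℓ U) (ho : Odd ℓ) {i p σ τ : ℕ}
    (hσ : σ ∈ Finset.Icc (F.m + 1) F.k) (hi : i ∈ F.lowerBase σ) (hτ : τ ≤ F.m)
    (hp : p ∈ F.upperBase τ) : p < σ ↔ i ≤ τ := by
  have hspine : F.lowerSpine = Finset.Icc (F.m + 1) F.k := if_pos ho
  have hA : ∀ i, i ∈ F.upperApexes ↔ i ≤ F.m ∧ (F.upperBase i).Nonempty := by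
    intro i
    rw [FrameworkData.upperApexes, Finset.mem_filter, Finset.mem_Icc]
    simp
  have hB : ∀ j, j ∈ F.lowerApexes ↔ j ∈ Finset.Icc (F.m + 1) F.k ∧ (F.lowerBase j).Nonempty := by
    intro j
    rw [FrameworkData.lowerApexes, Finset.mem_filter, hspine]
  refine lt_iff_le_of_interleaved ((hA 0).2 ⟨Nat.zero_le _, F.upper_zero⟩)
    (fun i hi i' hi' h => F.upper_nested i i' h ((hA i').1 hi').1)
    (fun j hj j' hj' h => F.odd_lower_nested ho j ((hB j).1 hj).1 j' ((hB j').1 hj').1 h)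
    (fun j hj i hi => ?_) (F.odd_upper_interleave ho) (F.odd_lower_interleave ho)
    ((hB σ).2 ⟨hσ, i, hi⟩) hi ((hA τ).2 ⟨hτ, p, hp⟩) hp
  have := (F.odd_lower_cover ho i).2 ⟨j, ((hB j).1 hj).1, hi⟩
  rw [Finset.mem_Icc] at this
  omega

/-! ### The length of the hole. -/

section Length

variable {K : SimpleGraph U} {H : Set U} {n : ℕ}

/-- Two paths with (ℓ - 1) / 2 vertices each make ℓ - 1 vertices, and exactly one of the two end
pairs is nonadjacent and needs one more vertex. -/
theorem length_eq_of_odd (hℓ : 5 ≤ ℓ) (ho : Odd ℓ) (C : CycleOn K H n)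
    (hK : ∀ u v, K.Adj u v → F.closureGraph.Adj u v)
    (P : F.upperTree.Compat K H) (P' : F.lowerTree.Compat K H) : n = ℓ := by
  classical
  have B := F.barSystem hℓ hK
  have E := B.exits C
  have E' := B.exits_last C
  have hmk := F.m_lt_k
  have hlast : F.lowerTree.last = F.k - F.m - 1 := if_pos ho
  have hidx : ∀ c, F.lowerIndex c = F.k - c := fun c => if_pos ho
  set Q := BarSystem.full K (Finset.Icc 1 F.k : Finset ℕ) F.bar F.barLength
  have hQ : ∀ p ∈ Q, p ∈ Finset.Icc 1 F.k := fun p hp => hp.1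
  have hupper : ∀ p ∈ Q, p ≤ F.m → F.bar p 0 = F.upperTree.apex p := fun p hp h => by
    rw [F.bar_first p (hQ p hp), F.upperTree_apex h]
  have hlower : ∀ p ∈ Q, F.m < p → F.bar p (F.barLength p) = F.lowerTree.apex (F.k - p) := by
    intro p hp h
    have := Finset.mem_Icc.1 (hQ p hp)
    rw [F.bar_last p (hQ p hp), F.lowerTree_apex (show F.k - p ≤ F.lowerTree.last by omega), hidx]
    congr 1
    omega
  have hleaf : ∀ p ∈ Q, F.m < p → ∃ c ≤ F.m, p ∈ F.upperBase c ∧ F.upperTree.IsLeaf c (F.bar p 0) := by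
    intro p hp h
    rcases F.upper_cases (hQ p hp) with h1 | ⟨-, c, hc, hpc⟩
    · omega
    · exact ⟨c, hc, hpc, F.bar_first p (hQ p hp) ▸ F.isLeaf_upper hc hpc⟩
  have hleaf' : ∀ p ∈ Q, p ≤ F.m → ∃ j ∈ Finset.Icc (F.m + 1) F.k, p ∈ F.lowerBase j ∧
      F.lowerTree.IsLeaf (F.k - j) (F.bar p (F.barLength p)) := by
    intro p hp h
    have h1 := Finset.mem_Icc.1 (hQ p hp)
    obtain ⟨j, hj, hpj⟩ := (F.odd_lower_cover ho p).1 (Finset.mem_Icc.2 ⟨h1.1, h⟩)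
    refine ⟨j, hj, hpj, F.bar_last p (hQ p hp) ▸ F.isLeaf_lower (c := F.k - j) ?_ ?_⟩
    · rw [Finset.mem_Icc] at hj
      change F.k - j ≤ F.lowerTree.last
      omega
    · rw [Finset.mem_Icc] at hj
      rw [hidx, show F.k - (F.k - j) = j by omega]
      exact hpj
  have hex : ∃ p ∈ Q, ∃ q ∈ Q, F.upperTree.Mate K (fun p => F.bar p 0) p q ∧
      F.lowerTree.Mate K (fun p => F.bar p (F.barLength p)) p q := by
    refine TentTree.exists_common_mates_of_apex C P P' E E' (B.full_nonempty C P P')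
      fun p hp => ?_
    rcases le_or_gt p F.m with h | h
    · exact Or.inl ⟨p, h, hupper p hp h⟩
    · have := Finset.mem_Icc.1 (hQ p hp)
      exact Or.inr ⟨F.k - p, by omega, hlower p hp h⟩
  obtain ⟨p, hp, q, hq, hpq, h, h'⟩ : ∃ p ∈ Q, ∃ q ∈ Q, p < q ∧
      F.upperTree.Mate K (fun p => F.bar p 0) p q ∧
      F.lowerTree.Mate K (fun p => F.bar p (F.barLength p)) p q := by
    obtain ⟨p, hp, q, hq, h, h'⟩ := hex
    rcases lt_or_gt_of_ne h.1 with h1 | h1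
    · exact ⟨p, hp, q, hq, h1, h, h'⟩
    · exact ⟨q, hq, p, hp, h1, h.symm, h'.symm⟩
  have hlen := B.length_eq_of_mates C hp hq h h'
  have hbl : ∀ i, F.barLength i = (ℓ - 3) / 2 := fun i => if_pos ho
  have hpQ := Finset.mem_Icc.1 (hQ p hp)
  have hqQ := Finset.mem_Icc.1 (hQ q hq)
  -- Two apexes are adjacent and two leaves are not. This settles the cases where both indices are
  -- at most `m`, or both exceed `m`; in the mixed case each side compares an apex with a leaf, and
  -- the interleaving lemma says that exactly one comparison succeeds.
  have hone : K.Adj (F.bar p 0) (F.bar q 0) ↔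
      ¬ K.Adj (F.bar p (F.barLength p)) (F.bar q (F.barLength q)) := by
    rcases le_or_gt q F.m with h1 | h1
    · obtain ⟨j, -, -, hj⟩ := hleaf' p hp (by omega)
      obtain ⟨j', -, -, hj'⟩ := hleaf' q hq h1
      refine iff_of_true ?_ (P'.not_adj_leaves hj hj')
      have hpH := E.mem_cycle C hp
      have hqH := E.mem_cycle C hq
      rw [hupper p hp (by omega)] at hpH ⊢
      rw [hupper q hq h1] at hqH ⊢
      exact TentTree.adj_of_apexes P (hpq.le.trans h1) h1 hpq.ne hpH hqH
    · obtain ⟨c, hc, hqc, hlq⟩ := hleaf q hq h1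
      rcases le_or_gt p F.m with h2 | h2
      · obtain ⟨j, hj, hpj, hlp⟩ := hleaf' p hp h2
        have hst := F.lt_iff_le_of_odd ho hj hpj hc hqc
        rw [Finset.mem_Icc] at hj
        have hpH := E.mem_cycle C hp
        have hqH := E'.mem_cycle C hq
        rw [hupper p hp h2] at hpH ⊢
        rw [hlower q hq h1] at hqH ⊢
        rw [P.adj_apex_leaf_iff h2 hlq (E.mem_cycle C hq) hpH, SimpleGraph.adj_comm,
          P'.adj_apex_leaf_iff (by omega) hlp (E'.mem_cycle C hp) hqH, ← hst]
        omega
      · obtain ⟨d, hd, hpd, hlp⟩ := hleaf p hp h2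
        refine iff_of_false (P.not_adj_leaves hlp hlq) (not_not.2 ?_)
        have hpH := E'.mem_cycle C hp
        have hqH := E'.mem_cycle C hq
        rw [hlower p hp h2] at hpH ⊢
        rw [hlower q hq h1] at hqH ⊢
        exact TentTree.adj_of_apexes P' (by omega) (by omega) (by omega) hpH hqH
  rw [hbl, hbl] at hlen
  rw [hbl, hbl] at hone
  obtain ⟨x, rfl⟩ := ho
  split_ifs at hlen <;> first | omega | tauto

/-- A path with index at most `m` has ℓ/2 vertices and is an apex at both ends; the others have ℓ/2
- 1 vertices and are leaves at both ends. Two apex paths need no extra vertex and two leaf paths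
need two. A mixed pair needs one, because the opposite orders of the tents make exactly one end pair
adjacent. -/
theorem length_eq_of_even (hℓ : 5 ≤ ℓ) (ho : ¬ Odd ℓ) (C : CycleOn K H n)
    (hK : ∀ u v, K.Adj u v → F.closureGraph.Adj u v)
    (P : F.upperTree.Compat K H) (P' : F.lowerTree.Compat K H) : n = ℓ := by
  classical
  have he := Nat.not_odd_iff_even.1 ho
  have B := F.barSystem hℓ hK
  have E := B.exits C
  have E' := B.exits_last C
  have hlast : F.lowerTree.last = F.m := if_neg ho
  have hidx : ∀ c ≤ F.m, F.lowerIndex (F.m - c) = if c = F.m then 0 else c + 1 := by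
    intro c hc
    unfold lowerIndex
    rw [if_neg ho]
    split_ifs <;> omega
  set Q := BarSystem.full K (Finset.Icc 1 F.k : Finset ℕ) F.bar F.barLength
  have hQ : ∀ p ∈ Q, p ∈ Finset.Icc 1 F.k := fun p hp => hp.1
  have hapex : ∀ p ∈ Q, p ≤ F.m → 1 ≤ p ∧ F.bar p 0 = F.upperTree.apex p ∧
      F.bar p (F.barLength p) = F.lowerTree.apex (F.m + 1 - p) := by
    intro p hp h
    have h1 := Finset.mem_Icc.1 (hQ p hp)
    refine ⟨h1.1, ?_, ?_⟩
    · rw [F.bar_first p (hQ p hp), F.upperTree_apex h]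
    · rw [F.bar_last p (hQ p hp),
        F.lowerTree_apex (show F.m + 1 - p ≤ F.lowerTree.last by omega)]
      congr 1
      unfold lowerIndex
      rw [if_neg ho, if_neg (by omega)]
      omega
  have hIcc : ∀ c ≤ F.m, ∀ p ∈ F.upperBase c, p ∈ Finset.Icc 1 F.k := by
    intro c hc p hp
    have := F.mem_upperBase hc hp
    rw [Finset.mem_Icc]
    omega
  have hleaf : ∀ c ≤ F.m, ∀ p ∈ F.upperBase c, F.upperTree.IsLeaf c (F.bar p 0) ∧
      F.lowerTree.IsLeaf (F.m - c) (F.bar p (F.barLength p)) := by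
    intro c hc p hp
    rw [F.bar_first p (hIcc c hc p hp), F.bar_last p (hIcc c hc p hp)]
    refine ⟨F.isLeaf_upper hc hp, F.isLeaf_lower ?_ ?_⟩
    · change F.m - c ≤ F.lowerTree.last
      omega
    · rw [F.even_lowerBase ho (Nat.sub_le _ _), Nat.sub_sub_self hc]
      exact hp
  have hbase : ∀ p ∈ Q, F.m < p → ∃ c ≤ F.m, p ∈ F.upperBase c := by
    intro p hp h
    rcases F.upper_cases (hQ p hp) with h1 | h1
    · omega
    · exact h1.2
  have hex : ∃ p ∈ Q, ∃ q ∈ Q, F.upperTree.Mate K (fun p => F.bar p 0) p q ∧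
      F.lowerTree.Mate K (fun p => F.bar p (F.barLength p)) p q := by
    refine TentTree.exists_common_mates_of_coarboreal C P P' E E' (B.full_nonempty C P P')
      rfl hlast hapex hleaf hbase fun c hc hne => ?_
    have := F.even_coarboreal he c hc hne
    rw [← hidx c hc] at this
    have h1 : (fun p : F.upperBase c => F.bar p 0) = fun p : F.upperBase c => F.a p :=
      funext fun p => F.bar_first p (hIcc c hc p p.2)
    have h2 : (fun p : F.upperBase c => F.bar p (F.barLength p)) =
        fun p : F.upperBase c => F.b p :=
      funext fun p => F.bar_last p (hIcc c hc p p.2)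
    rw [h1, h2]
    exact this
  obtain ⟨p, hp, q, hq, hpq, h, h'⟩ : ∃ p ∈ Q, ∃ q ∈ Q, p < q ∧
      F.upperTree.Mate K (fun p => F.bar p 0) p q ∧
      F.lowerTree.Mate K (fun p => F.bar p (F.barLength p)) p q := by
    obtain ⟨p, hp, q, hq, h, h'⟩ := hex
    rcases lt_or_gt_of_ne h.1 with h1 | h1
    · exact ⟨p, hp, q, hq, h1, h, h'⟩
    · exact ⟨q, hq, p, hp, h1, h.symm, h'.symm⟩
  have hlen := B.length_eq_of_mates C hp hq h h'
  have hbl : ∀ i, F.barLength i = if i ≤ F.m then ℓ / 2 - 1 else ℓ / 2 - 2 := fun i => if_neg ho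
  have hp1 := E.mem_cycle C hp
  have hp2 := E'.mem_cycle C hp
  have hq1 := E.mem_cycle C hq
  have hq2 := E'.mem_cycle C hq
  obtain ⟨x, rfl⟩ := he
  rcases le_or_gt q F.m with h1 | h1
  · have hpm : p ≤ F.m := by omega
    obtain ⟨h3, h4, h5⟩ := hapex p hp hpm
    obtain ⟨h3', h4', h5'⟩ := hapex q hq h1
    have ht : K.Adj (F.bar p 0) (F.bar q 0) := by
      rw [h4] at hp1 ⊢
      rw [h4'] at hq1 ⊢
      exact TentTree.adj_of_apexes P hpm h1 hpq.ne hp1 hq1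
    have hb : K.Adj (F.bar p (F.barLength p)) (F.bar q (F.barLength q)) := by
      rw [h5] at hp2 ⊢
      rw [h5'] at hq2 ⊢
      exact TentTree.adj_of_apexes P' (by omega) (by omega) (by omega) hp2 hq2
    rw [if_pos ht, if_pos hb, hbl, hbl, if_pos hpm, if_pos h1] at hlen
    omega
  · obtain ⟨c, hc, hqc⟩ := hbase q hq h1
    obtain ⟨hlq, hlq'⟩ := hleaf c hc q hqc
    rcases le_or_gt p F.m with h2 | h2
    · obtain ⟨h3, h4, h5⟩ := hapex p hp h2
      have ht : K.Adj (F.bar p 0) (F.bar q 0) ↔ p ≤ c := by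
        rw [h4] at hp1 ⊢
        exact P.adj_apex_leaf_iff h2 hlq hq1 hp1
      have hb : K.Adj (F.bar p (F.barLength p)) (F.bar q (F.barLength q)) ↔ ¬ p ≤ c := by
        rw [h5] at hp2 ⊢
        rw [P'.adj_apex_leaf_iff (by omega) hlq' hq2 hp2]
        omega
      simp only [ht, hb] at hlen
      rw [hbl, hbl, if_pos h2, if_neg (not_le.2 h1)] at hlen
      split_ifs at hlen <;> omega
    · obtain ⟨d, hd, hpd⟩ := hbase p hp h2
      obtain ⟨hlp, hlp'⟩ := hleaf d hd p hpd
      rw [if_neg (P.not_adj_leaves hlp hlq), if_neg (P'.not_adj_leaves hlp' hlq'), hbl, hbl,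
        if_neg (not_le.2 h1), if_neg (not_le.2 h2)] at hlen
      omega

end Length

theorem IsBlowup.isHoled (hℓ : 5 ≤ ℓ) (h : F.IsBlowup G) : IsHoled G ℓ := by
  obtain ⟨B⟩ := h
  rintro n hn ⟨c⟩
  choose τ hτ hτu using B.bag_partition
  have hτiff : ∀ v t, v ∈ B.bag t ↔ τ v = t :=
    fun v t => ⟨fun h => (hτu v t h).symm, fun h => h ▸ hτ v⟩
  have hinj := B.injective_comp hτiff hn c
  have C := cycleOn_map hn ⟨τ ∘ c, hinj⟩
  rw [Function.Embedding.coeFn_mk] at C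
  have hK : ∀ u v, ((SimpleGraph.cycleGraph n).map (τ ∘ c)).Adj u v → F.closureGraph.Adj u v := by
    rintro _ _ ⟨hne, i, j, hij, rfl, rfl⟩
    by_contra hnadj
    exact B.bag_nonadj _ _ hne hnadj _ (hτ _) _ (hτ _) (c.map_adj_iff.2 hij)
  have P := B.compat_upper hτiff c hinj
  have P' := B.compat_lower hτiff c hinj
  by_cases ho : Odd ℓ
  · exact length_eq_of_odd hℓ ho C hK P P'
  · exact length_eq_of_even hℓ ho C hK P P'

end Framework

theorem mainTheorem2 {V : Type*} [Finite V] (G : SimpleGraph V) (ℓ : ℕ) (hℓ : 5 ≤ ℓ) :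
    (IsCycleBlowup G ℓ → IsHoled G ℓ) ∧
      (∀ (U : Type*) (F : Framework ℓ U), F.IsBlowup G → IsHoled G ℓ) :=
  ⟨fun h => h.isHoled hℓ, fun _ _ h => h.isHoled hℓ⟩
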